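/- Let $\mathcal M=(n,\mathcal S,(\mathcal A_i)_{i\in[n]},P,(r_i)_{i\in[n]},\gamma,\rho)$ be a stochastic game with $n\ge 1$ agents, finite state space $\mathcal S$, finite action spaces $\mathcal A_i$ (with $\mathcal A=\prod_i\mathcal A_i$), transition kernel $P:\mathcal S\times\mathcal A\to\Delta(\mathcal S)$, rewards $r_i:\mathcal S\times\mathcal A\to[0,1]$, discount factor $\gamma\in(0,1)$ and initial distribution $\rho$. Policies are decentralized: $\pi(\boldsymbol a|s)=\prod_i\pi_i(a_i|s)$ with $\pi_i:\mathcal S\to\Delta(\mathcal A_i)$. For $f:\mathcal S\times\mathcal A\to\mathbb R$ put $V_f^\pi(s)=\mathbb E^\pi[\sum_{t\ge0}\gamma^tf(s^t,\boldsymbol a^t)\mid s^0=s]$, $Q_f^\pi(s,\boldsymbol a)=\mathbb E^\pi[\sum_{t\ge0}\gamma^tf(s^t,\boldsymbol a^t)\mid s^0=s,\boldsymbol a^0=\boldsymbol a]$, $V_f^\pi(\rho)=\mathbb E_{s\sim\rho}V_f^\pi(s)$, and write $V_i=V_{r_i}$, $Q_i=Q_{r_i}$. Let $\bar A_i^\pi(s,a_i)=\sum_{a_{-i}}\pi_{-i}(a_{-i}|s)\,[Q_i^\pi(s,a_i,a_{-i})-V_i^\pi(s)]$,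 $d_\rho^\pi(s)=(1-\gamma)\,\mathbb E^\pi[\sum_{t\ge0}\gamma^t\mathbf 1(s^t=s)\mid s^0\sim\rho]$, and $$\text{NE-gap}(\pi)=\max_{i\in[n],\ \pi_i':\mathcal S\to\Delta(\mathcal A_i)}\big[V_i^{\pi_i',\pi_{-i}}(\rho)-V_i^{\pi}(\rho)\big].$$ Assume that $\mathcal M$ is a Markov potential game: there is $\phi:\mathcal S\times\mathcal A\to[0,\phi_{max}]$, with $\phi_{max}>0$, such that $V_i^{\pi_i',\pi_{-i}}(s)-V_i^{\pi_i,\pi_{-i}}(s)=V_\phi^{\pi_i',\pi_{-i}}(s)-V_\phi^{\pi_i,\pi_{-i}}(s)$ for all $i,s,\pi_i,\pi_i',\pi_{-i}$. Let $\pi^0$ be any softmax policy, $\pi_i^0(a|s)=\exp(\theta_{i,s,a})/\sum_b\exp(\theta_{i,s,b})$, and let $(\pi^k)_{k\ge0}$ be generated by independent natural policy gradient $$\pi_i^{k+1}(a_i|s)\propto\pi_i^k(a_i|s)\exp\Big(\frac{\eta\,\bar A_i^{\pi^k}(s,a_i)}{1-\gamma}\Big),\qquad \eta=\frac{(1-\gamma)^2}{2\sqrt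 n\,\phi_{max}}.$$ Let $B_i^k(s)=\arg\max_{a}\bar A_i^{\pi^k}(s,a)$ be the set of best actions and $$M=\sup_\pi\max_s\frac1{d_\rho^\pi(s)},\quad c_K=\min_{i,\,s,\,0\le k\le K-1}\ \sum_{a\in B_i^k(s)}\pi_i^k(a|s),\quad c=\inf_{K\ge 1}c_K=\inf_{i,\,s,\,k\ge0}\ \sum_{a\in B_i^k(s)}\pi_i^k(a|s),$$ $$\delta^k=\min_{i,s}\Big[\max_{a}\bar A_i^{\pi^k}(s,a)-\max_{a\notin B_i^k(s)}\bar A_i^{\pi^k}(s,a)\Big],\qquad \delta_K=\min_{0\le k\le K-1}\delta^k,$$ where pairs $(i,s)$ with $B_i^k(s)=\mathcal A_i$ are left out of the minimum (and $\min\emptyset=\infty$). The right-hand sides below are read in $[0,\infty]$, with $1/0=\infty$ and $1/\infty=0$; in particular they are $\infty$ if $M=\infty$ or $c=0$. Then for every $K\ge1$ we have $c_K>0$, $\delta_K>0$ and $$\frac1K\sum_{k=0}^{K-1}\text{NE-gap}(\pi^k)\le\frac{2M\phi_{max}}{K(1-\gamma)}\Big(1+\frac{2\sqrt n\,\phi_{max}}{c\,\delta_K(1-\gamma)}\Big),$$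 and the same bound holds with $c$ replaced by $c_K$. Consequently the iteration complexity is $O(1/\epsilon)$: for every $\epsilon>0$ and every integer $$K\ge\max\Big\{1,\ \frac{2M\phi_{max}}{\epsilon(1-\gamma)}\Big(1+\frac{2\sqrt n\,\phi_{max}}{c\,\delta_\infty(1-\gamma)}\Big)\Big\},\qquad\delta_\infty=\inf_{k\ge0}\delta^k,$$ we have $\frac1K\sum_{k=0}^{K-1}\text{NE-gap}(\pi^k)\le\epsilon$. -/

import Mathlib

open Finset
open scoped ENNReal

noncomputable section

/-- A finite stochastic game with `n` agents, state space `S`, action spaces `A i`, transition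
kernel `P`, rewards `r i` with values in `[0, 1]`, discount factor `γ ∈ (0, 1)` and initial
distribution `ρ`. Probability vectors are points of Mathlib's `stdSimplex`. -/
structure StochasticGame (n : ℕ) (S : Type*) (A : Fin n → Type*)
    [Fintype S] [∀ i, Fintype (A i)] where
  P : S → (∀ i, A i) → stdSimplex ℝ S
  r : Fin n → S → (∀ i, A i) → ℝ
  r_mem : ∀ i s a, r i s a ∈ Set.Icc (0 : ℝ) 1
  γ : ℝ
  γ_mem : γ ∈ Set.Ioo (0 : ℝ) 1
  ρ : stdSimplex ℝ S

/-- A local policy `π_i : S → Δ(A_i)` of one agent. -/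
abbrev LocalPolicy (S B : Type*) [Fintype B] := S → stdSimplex ℝ B

/-- A decentralized joint policy: one local policy for every agent. -/
abbrev JointPolicy {n : ℕ} (S : Type*) (A : Fin n → Type*) [∀ i, Fintype (A i)] :=
  ∀ i, LocalPolicy S (A i)

/-- A softmax policy: `π_i(a|s) = exp(θ_{i,s,a}) / ∑_b exp(θ_{i,s,b})` for some parameters. -/
def IsSoftmax {n : ℕ} {S : Type*} {A : Fin n → Type*} [∀ i, Fintype (A i)]
    (π : JointPolicy S A) : Prop :=
  ∃ θ : ∀ i, S → A i → ℝ, ∀ i s a,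
    (π i s).1 a = Real.exp (θ i s a) / ∑ b, Real.exp (θ i s b)

namespace StochasticGame

variable {n : ℕ} {S : Type*} {A : Fin n → Type*} [Fintype S] [DecidableEq S]
  [∀ i, Fintype (A i)] [∀ i, DecidableEq (A i)]

/-- `π(a|s) = ∏ i, π_i(a_i|s)`. -/
def jointProb (π : JointPolicy S A) (s : S) (a : ∀ i, A i) : ℝ :=
  ∏ i, (π i s).1 (a i)

/-- The law of `(s^t, a^t)` when `(s^0, a^0)` has law `ν`, the next state is drawn from
`P(·|s, a)` and, from time `1` on, actions are drawn from `π`. -/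
def pairLaw (G : StochasticGame n S A) (π : JointPolicy S A) (ν : S → (∀ i, A i) → ℝ) :
    ℕ → S → (∀ i, A i) → ℝ
  | 0 => ν
  | t + 1 => fun s' a' =>
      (∑ s, ∑ a, G.pairLaw π ν t s a * (G.P s a).1 s') * jointProb π s' a'

/-- `𝔼^π[∑_t γ^t f(s^t, a^t)]` when `(s^0, a^0)` has law `ν`. -/
def discounted (G : StochasticGame n S A) (π : JointPolicy S A) (ν : S → (∀ i, A i) → ℝ)
    (f : S → (∀ i, A i) → ℝ) : ℝ :=
  ∑' t : ℕ, G.γ ^ t * ∑ s, ∑ a, G.pairLaw π ν t s a * f s a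

/-- The law of `(s^0, a^0)` when `s^0` has law `μ` and `a^0` is drawn from `π`. -/
def startLaw (π : JointPolicy S A) (μ : S → ℝ) : S → (∀ i, A i) → ℝ :=
  fun s a => μ s * jointProb π s a

/-- `𝔼^π[∑_t γ^t f(s^t, a^t) | s^0 = s]`. For `f = r_i` this is `V_i^π(s)`, for a potential
function `f = φ` it is `Φ^π(s)`. -/
def value (G : StochasticGame n S A) (f : S → (∀ i, A i) → ℝ) (π : JointPolicy S A) (s : S) :
    ℝ :=
  G.discounted π (startLaw π (Pi.single s 1)) f

/-- `V^π(ρ) = 𝔼_{s ∼ ρ}[V^π(s)]`. -/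
def valueInit (G : StochasticGame n S A) (f : S → (∀ i, A i) → ℝ) (π : JointPolicy S A) : ℝ :=
  ∑ s, G.ρ.1 s * G.value f π s

/-- `Q^π(s, a) = 𝔼^π[∑_t γ^t f(s^t, a^t) | s^0 = s, a^0 = a]`. -/
def qValue (G : StochasticGame n S A) (f : S → (∀ i, A i) → ℝ) (π : JointPolicy S A) (s : S)
    (a : ∀ i, A i) : ℝ :=
  G.discounted π (Pi.single s (Pi.single a 1)) f

/-- The advantage function `A_i^π(s, a) = Q_i^π(s, a) - V_i^π(s)`. -/
def advantage (G : StochasticGame n S A) (i : Fin n) (π : JointPolicy S A) (s : S)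
    (a : ∀ i, A i) : ℝ :=
  G.qValue (G.r i) π s a - G.value (G.r i) π s

/-- The marginalized advantage
`∑_{a_{-i}} π_{-i}(a_{-i}|s) A_i^π(s, a_i, a_{-i})`; the profiles `a_{-i}` of the other agents
are enumerated as the joint actions whose `i`-th entry is `ai`. -/
def margAdvantage (G : StochasticGame n S A) (i : Fin n) (π : JointPolicy S A) (s : S)
    (ai : A i) : ℝ :=
  ∑ a : (∀ j, A j) with a i = ai, (∏ j ∈ univ.erase i, (π j s).1 (a j)) * G.advantage i π s a

/-- The discounted state visitation distribution
`d_ρ^π(s) = (1 - γ) 𝔼^π[∑_t γ^t 1(s^t = s) | s^0 ∼ ρ]`. -/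
def visitation (G : StochasticGame n S A) (π : JointPolicy S A) (s : S) : ℝ :=
  (1 - G.γ) * G.discounted π (startLaw π G.ρ.1) (fun s' _ => if s' = s then 1 else 0)

/-- `φ` is a potential function of the game: every unilateral deviation, of any agent, from
any joint policy and at any initial state, changes the value of the deviating agent and the
total discounted potential by the same amount. -/
def IsPotential (G : StochasticGame n S A) (φ : S → (∀ i, A i) → ℝ) : Prop :=
  ∀ (i : Fin n) (s : S) (π : JointPolicy S A) (π' : LocalPolicy S (A i)),
    G.value (G.r i) (Function.update π i π') s - G.value (G.r i) π s =
      G.value φ (Function.update π i π') s - G.value φ π s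

/-- The NE-gap: the largest gain of value, from the initial distribution, that one agent can
achieve by a unilateral change of its local policy. -/
def neGap (G : StochasticGame n S A) (π : JointPolicy S A) : ℝ :=
  ⨆ i : Fin n, ⨆ π' : LocalPolicy S (A i),
    (G.valueInit (G.r i) (Function.update π i π') - G.valueInit (G.r i) π)

/-- A sequence of policies follows independent natural policy gradient with step size `η`:
`π_i^{k+1}(a|s) ∝ π_i^k(a|s) exp(η Ā_i^{π^k}(s, a) / (1 - γ))`. -/
def IsNPG (G : StochasticGame n S A) (η : ℝ) (π : ℕ → JointPolicy S A) : Prop :=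
  ∀ k i s a, (π (k + 1) i s).1 a =
    (π k i s).1 a * Real.exp (η * G.margAdvantage i (π k) s a / (1 - G.γ)) /
      ∑ b, (π k i s).1 b * Real.exp (η * G.margAdvantage i (π k) s b / (1 - G.γ))

/-- The set of the best actions of agent `i` in state `s`: the maximizers of `Ā_i^π(s, ·)`. -/
def bestActions (G : StochasticGame n S A) (π : JointPolicy S A) (i : Fin n) (s : S) :
    Set (A i) :=
  {a | ∀ b, G.margAdvantage i π s b ≤ G.margAdvantage i π s a}

open Classical in
/-- The probability that `π_i(·|s)` gives to the best actions of agent `i` in state `s`. -/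
def bestMass (G : StochasticGame n S A) (π : JointPolicy S A) (i : Fin n) (s : S) : ℝ :=
  ∑ a with a ∈ G.bestActions π i s, (π i s).1 a

/-- The suboptimality gap of `π`: the minimum over agents `i` and states `s` of the difference
of `Ā_i^π(s, ·)` between a best and a second best action, that is, of the least difference
between a best and a non-best action. A pair `(i, s)` for which all actions are best imposes
no constraint (infimum of the empty set, `∞`). -/
def subGap (G : StochasticGame n S A) (π : JointPolicy S A) : ℝ≥0∞ :=
  ⨅ i : Fin n, ⨅ s : S, ⨅ a ∈ G.bestActions π i s, ⨅ b ∉ G.bestActions π i s,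
    ENNReal.ofReal (G.margAdvantage i π s a - G.margAdvantage i π s b)

/-- The distribution mismatch coefficient `M = sup_π max_s 1 / d_ρ^π(s)`, in `[0, ∞]`. -/
def mismatch (G : StochasticGame n S A) : ℝ≥0∞ :=
  ⨆ π : JointPolicy S A, ⨆ s : S, (ENNReal.ofReal (G.visitation π s))⁻¹

/-- `c = inf_{i, s, k ≥ 0}` of the mass on the best actions along a sequence of policies. -/
def infBestMass (G : StochasticGame n S A) (π : ℕ → JointPolicy S A) : ℝ≥0∞ :=
  ⨅ k : ℕ, ⨅ i : Fin n, ⨅ s : S, ENNReal.ofReal (G.bestMass (π k) i s)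

/-- `c_K`: the same infimum over the first `K` policies only. -/
def minBestMass (G : StochasticGame n S A) (π : ℕ → JointPolicy S A) (K : ℕ) : ℝ≥0∞ :=
  ⨅ k ∈ range K, ⨅ i : Fin n, ⨅ s : S, ENNReal.ofReal (G.bestMass (π k) i s)

/-- `δ_K = min_{0 ≤ k ≤ K - 1} δ^k`. -/
def minSubGap (G : StochasticGame n S A) (π : ℕ → JointPolicy S A) (K : ℕ) : ℝ≥0∞ :=
  ⨅ k ∈ range K, G.subGap (π k)

/-- The infimum of `δ^k` over all `k ≥ 0`. -/
def infSubGap (G : StochasticGame n S A) (π : ℕ → JointPolicy S A) : ℝ≥0∞ :=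
  ⨅ k : ℕ, G.subGap (π k)

end StochasticGame

end

/-!
Let `J p q` be the symmetrized Kullback-Leibler divergence. Everything is driven by comparing one
step of natural policy gradient with the growth of the potential `V_φ`.

*Growth of the potential.* By the performance difference formula
(`StochasticGame.valueInit_sub_valueInit`), `V_φ` changes in one step by the advantage of `φ`
collected along the new policy. In each state this is an expectation under a product
distribution, and changing the factors one at a time shows that it equals
`∑ i, 𝔼_{π'_i}[Ā_i]` up to `√n φmax / (1 - γ) * ∑ i, J π'_i π_i` (`abs_sum_prod_sub_le`); the
factor `√n` comes from bounding the distance of product distributions by their divergence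
(`sq_sum_abs_sub_le_symKL`), which is additive over the factors (`symKL_prod`). Here the
marginalized advantages of `φ` may be replaced by those of the rewards
(`StochasticGame.IsPotential.margAdvantage_eq`), since both can be read off from a deviation in a
single state. For multiplicative weights `J π'_i π_i` is the step size times `𝔼_{π'_i}[Ā_i]`
(`mul_sum_sub_mul_eq_symKL`), so for the given step size the error eats up at most half of the
gain (`StochasticGame.half_stepGain_le`).

*The gap of an iterate.* A unilateral deviation gains at most the visited maxima of `Ā_i`; changing
the visitation distribution to that of the next iterate costs a factor `M`
(`StochasticGame.neGap_le`). A step of multiplicative weights already attains the fraction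
`x / (1 + x)` of the maximum of `Ā_i`, where `x` is the product of the mass `c` of the best actions,
the rate, and the suboptimality gap `δ` (`mul_max_le_one_add_mul_sum`, by Chebyshev's sum
inequality).

So each NE-gap is at most `2 M (1 + 1 / x)` times an increment of `V_φ(ρ)`. The increments
telescope and `V_φ(ρ)` takes values in `[0, φmax / (1 - γ)]`.
-/

open Finset
open scoped ENNReal

noncomputable section

/-! ### Product weights and their marginals -/

section ProductWeights

variable {ι : Type*} [Fintype ι] [DecidableEq ι] {A : ι → Type*} [∀ i, Fintype (A i)]

lemma sum_prod_eq_one {w : ∀ i, A i → ℝ} (hw : ∀ i, ∑ b, w i b = 1) :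
    ∑ a : (∀ i, A i), ∏ j, w j (a j) = 1 := by
  have := Finset.prod_univ_sum (fun i => (univ : Finset (A i))) w
  rw [Fintype.piFinset_univ] at this
  rw [← this]
  simp [hw]

variable [∀ i, DecidableEq (A i)]

/-- The conditional expectation of `F` under the product weight `∏ j, w j` when the `i`-th entry
is fixed to be `b`; the other entries are enumerated as the profiles with `i`-th entry `b`. -/
def marginal (w : ∀ i, A i → ℝ) (F : (∀ i, A i) → ℝ) (i : ι) (b : A i) : ℝ :=
  ∑ a : (∀ j, A j) with a i = b, (∏ j ∈ univ.erase i, w j (a j)) * F a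

lemma sum_prod_mul_eq_sum_marginal (w : ∀ i, A i → ℝ) (F : (∀ i, A i) → ℝ) (i : ι) :
    ∑ a, (∏ j, w j (a j)) * F a = ∑ b, w i b * marginal w F i b := by
  rw [← Finset.sum_fiberwise univ (fun a : (∀ j, A j) => a i)]
  refine Finset.sum_congr rfl fun b _ => ?_
  rw [marginal, Finset.mul_sum]
  refine Finset.sum_congr rfl fun a ha => ?_
  rw [← Finset.mul_prod_erase univ (fun j => w j (a j)) (mem_univ i), (mem_filter.1 ha).2,
    mul_assoc]

lemma marginal_congr {w w' : ∀ i, A i → ℝ} {i : ι} (h : ∀ j, j ≠ i → w j = w' j)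
    (F : (∀ i, A i) → ℝ) (b : A i) : marginal w F i b = marginal w' F i b := by
  refine Finset.sum_congr rfl fun a _ => ?_
  congr 1
  exact Finset.prod_congr rfl fun j hj => by rw [h j (ne_of_mem_erase hj)]

lemma marginal_comp_update (w : ∀ i, A i → ℝ) (F : (∀ i, A i) → ℝ) (i : ι) (b b' : A i) :
    marginal w (fun a => F (Function.update a i b)) i b' = marginal w F i b := by
  refine Finset.sum_nbij' (fun a => Function.update a i b) (fun a => Function.update a i b')
    ?_ ?_ ?_ ?_ ?_
  · intro a _; simp
  · intro a _; simp
  · intro a ha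
    have : a i = b' := (mem_filter.1 ha).2
    simp [← this]
  · intro a ha
    have : a i = b := (mem_filter.1 ha).2
    simp [← this]
  · intro a _
    congr 1
    refine Finset.prod_congr rfl fun j hj => ?_
    rw [Function.update_of_ne (ne_of_mem_erase hj)]

/-- Since `w i` has mass one, the `i`-th entry may be drawn and then overwritten: a marginal is an
expectation under the full product weight. -/
lemma marginal_eq_sum_update {w : ∀ i, A i → ℝ} {i : ι} (hw : ∑ b, w i b = 1)
    (F : (∀ i, A i) → ℝ) (b : A i) :
    marginal w F i b = ∑ a, (∏ j, w j (a j)) * F (Function.update a i b) := by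
  rw [sum_prod_mul_eq_sum_marginal w _ i]
  simp_rw [marginal_comp_update, ← Finset.sum_mul, hw, one_mul]

/-- The `i`-th marginal distribution of a product distribution is its `i`-th factor. -/
lemma sum_prod_mul_apply {w : ∀ i, A i → ℝ} (hw : ∀ i, ∑ b, w i b = 1) (i : ι) (g : A i → ℝ) :
    ∑ a : (∀ i, A i), (∏ j, w j (a j)) * g (a i) = ∑ b, w i b * g b := by
  rw [sum_prod_mul_eq_sum_marginal w (fun a => g (a i)) i]
  refine Finset.sum_congr rfl fun b _ => ?_
  rw [marginal_eq_sum_update (hw i)]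
  simp [← Finset.sum_mul, sum_prod_eq_one hw]

/-! ### The symmetrized Kullback-Leibler divergence -/

/-- The symmetrized Kullback-Leibler divergence `KL(p, q) + KL(q, p)`, written as one sum. -/
def symKL {α : Type*} [Fintype α] (p q : α → ℝ) : ℝ :=
  ∑ a, (p a - q a) * (Real.log (p a) - Real.log (q a))

/-- The logarithmic mean of two positive numbers is at most their arithmetic mean. -/
lemma two_mul_sub_sq_div_add_le {x y : ℝ} (hx : 0 < x) (hy : 0 < y) :
    2 * ((x - y) ^ 2 / (x + y)) ≤ (x - y) * (Real.log x - Real.log y) := by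
  wlog h : y ≤ x generalizing x y
  · have := this hy hx (le_of_not_ge h)
    rw [add_comm y x, show (y - x) ^ 2 = (x - y) ^ 2 by ring] at this
    linarith
  have h1 := Real.le_log_one_add_of_nonneg (x := x / y - 1) (by
    rw [sub_nonneg, le_div_iff₀ hy]; linarith)
  rw [show 1 + (x / y - 1) = x / y by ring, Real.log_div hx.ne' hy.ne'] at h1
  have h2 : 2 * (x / y - 1) / (x / y - 1 + 2) = 2 * (x - y) / (x + y) := by
    have : x + y ≠ 0 := by positivity
    have hxy : x / y - 1 + 2 = (x + y) / y := by field_simp; ring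
    rw [hxy]
    field_simp
  rw [h2] at h1
  calc 2 * ((x - y) ^ 2 / (x + y)) = (x - y) * (2 * (x - y) / (x + y)) := by ring
    _ ≤ _ := mul_le_mul_of_nonneg_left h1 (sub_nonneg.2 h)

lemma symKL_nonneg {α : Type*} [Fintype α] {p q : α → ℝ} (hp : ∀ a, 0 < p a)
    (hq : ∀ a, 0 < q a) : 0 ≤ symKL p q :=
  Finset.sum_nonneg fun a _ => le_trans (by have := hp a; have := hq a; positivity)
    (two_mul_sub_sq_div_add_le (hp a) (hq a))

/-- A symmetrized Pinsker inequality. -/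
lemma sq_sum_abs_sub_le_symKL {α : Type*} [Fintype α] {p q : α → ℝ} (hp : ∀ a, 0 < p a)
    (hq : ∀ a, 0 < q a) (hp1 : ∑ a, p a = 1) (hq1 : ∑ a, q a = 1) :
    (∑ a, |p a - q a|) ^ 2 ≤ symKL p q := by
  have h := Finset.sum_sq_le_sum_mul_sum_of_sq_le_mul univ
    (r := fun a => |p a - q a|) (f := fun a => (p a - q a) ^ 2 / (p a + q a))
    (g := fun a => p a + q a) (fun a _ => by have := hp a; have := hq a; positivity)
    (fun a _ => by have := hp a; have := hq a; positivity)
    (fun a _ => by have := hp a; have := hq a; rw [sq_abs]; field_simp; exact le_rfl)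
  rw [Finset.sum_add_distrib, hp1, hq1] at h
  refine h.trans ?_
  rw [mul_comm, one_add_one_eq_two, Finset.mul_sum]
  exact Finset.sum_le_sum fun a _ => two_mul_sub_sq_div_add_le (hp a) (hq a)

/-- The symmetrized divergence of two product distributions is the sum of the divergences of the
factors. -/
lemma symKL_prod {w w' : ∀ i, A i → ℝ} (hw : ∀ i b, 0 < w i b) (hw' : ∀ i b, 0 < w' i b)
    (hw1 : ∀ i, ∑ b, w i b = 1) (hw1' : ∀ i, ∑ b, w' i b = 1) :
    symKL (fun a : (∀ i, A i) => ∏ j, w j (a j)) (fun a => ∏ j, w' j (a j)) =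
      ∑ i, symKL (w i) (w' i) := by
  unfold symKL
  simp_rw [Real.log_prod (fun j (_ : j ∈ univ) => (hw j _).ne'),
    Real.log_prod (fun j (_ : j ∈ univ) => (hw' j _).ne'), ← Finset.sum_sub_distrib,
    Finset.mul_sum]
  rw [Finset.sum_comm]
  refine Finset.sum_congr rfl fun i _ => ?_
  simp_rw [sub_mul, Finset.sum_sub_distrib]
  rw [sum_prod_mul_apply hw1 i (fun b => Real.log (w i b) - Real.log (w' i b)),
    sum_prod_mul_apply hw1' i (fun b => Real.log (w i b) - Real.log (w' i b))]

end ProductWeights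

/-! ### First-order expansion of an expectation under product distributions -/

section Hybrid

variable {n : ℕ} {A : Fin n → Type*} [∀ i, Fintype (A i)] [∀ i, DecidableEq (A i)]

/-- Replacing the factors of a product distribution one by one, the change of the expectation of a
bounded function is the sum of the changes caused by each factor alone, up to an error of order
`√n` times the divergence. Bounding the distance of the hybrid distributions from the original one
by the divergence of the products, not by the sum of the distances of the factors, gives `√n` in
place of `n`. -/
lemma abs_sum_prod_sub_le {w w' : ∀ i, A i → ℝ} (hw : ∀ i b, 0 < w i b)
    (hw' : ∀ i b, 0 < w' i b) (hw1 : ∀ i, ∑ b, w i b = 1) (hw1' : ∀ i, ∑ b, w' i b = 1)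
    {F : (∀ i, A i) → ℝ} {R : ℝ} (hF : ∀ a, |F a| ≤ R) (hR : 0 ≤ R) :
    |(∑ a, (∏ j, w' j (a j)) * F a - ∑ a, (∏ j, w j (a j)) * F a) -
        ∑ i, ∑ b, (w' i b - w i b) * marginal w F i b| ≤
      √n * R * ∑ i, symKL (w' i) (w i) := by
  set J := ∑ i, symKL (w' i) (w i) with hJ
  have hJ0 : ∀ i, 0 ≤ symKL (w' i) (w i) := fun i => symKL_nonneg (hw' i) (hw i)
  have hJnn : 0 ≤ J := Finset.sum_nonneg fun i _ => hJ0 i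
  let h : ℕ → ∀ i, A i → ℝ := fun m i => if (i : ℕ) < m then w' i else w i
  have hh : ∀ m i b, 0 < h m i b := by
    intro m i b; simp only [h]; split_ifs; exacts [hw' i b, hw i b]
  have hh1 : ∀ m i, ∑ b, h m i b = 1 := by
    intro m i; simp only [h]; split_ifs; exacts [hw1' i, hw1 i]
  have hdist : ∀ m, ∑ a : (∀ i, A i), |∏ j, h m j (a j) - ∏ j, w j (a j)| ≤ √J := by
    intro m
    refine Real.le_sqrt_of_sq_le ?_
    refine (sq_sum_abs_sub_le_symKL (fun a => prod_pos fun j _ => hh m j _)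
      (fun a => prod_pos fun j _ => hw j _) (sum_prod_eq_one (hh1 m))
      (sum_prod_eq_one hw1)).trans ?_
    rw [symKL_prod (hh m) hw (hh1 m) hw1]
    refine Finset.sum_le_sum fun i _ => ?_
    simp only [h]
    split_ifs
    · exact le_rfl
    · simpa [symKL] using hJ0 i
  have htel : ∑ a, (∏ j, w' j (a j)) * F a - ∑ a, (∏ j, w j (a j)) * F a =
      ∑ i : Fin n, ∑ b, (w' i b - w i b) * marginal (h i) F i b := by
    have h1 : ∑ a, (∏ j, w' j (a j)) * F a = ∑ a, (∏ j, h n j (a j)) * F a := by simp [h]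
    have h0 : ∑ a, (∏ j, w j (a j)) * F a = ∑ a, (∏ j, h 0 j (a j)) * F a := by simp [h]
    rw [h1, h0, ← Finset.sum_range_sub (fun m => ∑ a, (∏ j, h m j (a j)) * F a),
      ← Fin.sum_univ_eq_sum_range
        (fun m => ∑ a, (∏ j, h (m + 1) j (a j)) * F a - ∑ a, (∏ j, h m j (a j)) * F a)]
    refine Finset.sum_congr rfl fun i _ => ?_
    rw [sum_prod_mul_eq_sum_marginal (h (i + 1)) F i, sum_prod_mul_eq_sum_marginal (h i) F i,
      ← Finset.sum_sub_distrib]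
    refine Finset.sum_congr rfl fun b _ => ?_
    rw [marginal_congr (w := h (i + 1)) (w' := h i) (fun j hj => ?_)]
    · simp [h, sub_mul]
    · have : (j : ℕ) ≠ i := fun e => hj (Fin.ext e)
      have h2 : (j : ℕ) < i + 1 ↔ (j : ℕ) < i := by omega
      simp only [h, h2]
  have hmarg : ∀ (i : Fin n) b, |marginal (h i) F i b - marginal w F i b| ≤ R * √J := by
    intro i b
    rw [marginal_eq_sum_update (hh1 i i), marginal_eq_sum_update (hw1 i),
      ← Finset.sum_sub_distrib]
    refine (Finset.abs_sum_le_sum_abs _ _).trans ?_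
    refine le_trans ?_ (mul_le_mul_of_nonneg_left (hdist i) hR)
    rw [Finset.mul_sum]
    refine Finset.sum_le_sum fun a _ => ?_
    rw [← sub_mul, abs_mul, mul_comm]
    exact mul_le_mul_of_nonneg_right (hF _) (abs_nonneg _)
  rw [htel, ← Finset.sum_sub_distrib]
  refine (Finset.abs_sum_le_sum_abs _ _).trans ?_
  have hterm : ∀ i : Fin n, |∑ b, (w' i b - w i b) * marginal (h i) F i b -
      ∑ b, (w' i b - w i b) * marginal w F i b| ≤ √(symKL (w' i) (w i)) * (R * √J) := by
    intro i
    rw [← Finset.sum_sub_distrib]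
    refine (Finset.abs_sum_le_sum_abs _ _).trans ?_
    refine le_trans ?_ (mul_le_mul_of_nonneg_right (Real.le_sqrt_of_sq_le
      (sq_sum_abs_sub_le_symKL (hw' i) (hw i) (hw1' i) (hw1 i))) (by positivity))
    rw [Finset.sum_mul]
    refine Finset.sum_le_sum fun b _ => ?_
    rw [← mul_sub, abs_mul]
    exact mul_le_mul_of_nonneg_left (hmarg i b) (abs_nonneg _)
  refine (Finset.sum_le_sum fun i _ => hterm i).trans ?_
  rw [← Finset.sum_mul]
  have hcs : ∑ i, √(symKL (w' i) (w i)) ≤ √n * √J := by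
    rw [← Real.sqrt_mul (Nat.cast_nonneg n)]
    refine Real.le_sqrt_of_sq_le ?_
    refine (sq_sum_le_card_mul_sum_sq).trans ?_
    simp [Real.sq_sqrt (hJ0 _), hJ]
  calc (∑ i, √(symKL (w' i) (w i))) * (R * √J) ≤ (√n * √J) * (R * √J) :=
        mul_le_mul_of_nonneg_right hcs (by positivity)
    _ = √n * R * (√J * √J) := by ring
    _ = √n * R * J := by rw [Real.mul_self_sqrt hJnn]

end Hybrid

/-! ### Multiplicative weights -/

section MultiplicativeWeights

variable {α : Type*}

/-- Chebyshev's sum inequality with weights, for `y` and a decreasing function of `y`. -/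
lemma sum_mul_sum_exp_neg_le (s : Finset α) {p y : α → ℝ} {β : ℝ} (hp : ∀ a, 0 ≤ p a)
    (hβ : 0 ≤ β) :
    (∑ a ∈ s, p a) * ∑ a ∈ s, p a * (y a * Real.exp (-(β * y a))) ≤
      (∑ a ∈ s, p a * y a) * ∑ a ∈ s, p a * Real.exp (-(β * y a)) := by
  set u : α → ℝ := fun a => Real.exp (-(β * y a))
  have h : ∑ a ∈ s, ∑ b ∈ s, p a * p b * ((y a - y b) * (u a - u b)) ≤ 0 := by
    refine Finset.sum_nonpos fun a _ => Finset.sum_nonpos fun b _ => ?_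
    refine mul_nonpos_of_nonneg_of_nonpos (mul_nonneg (hp a) (hp b)) ?_
    rcases le_total (y a) (y b) with hab | hab
    · refine mul_nonpos_of_nonpos_of_nonneg (sub_nonpos.2 hab) (sub_nonneg.2 ?_)
      exact Real.exp_le_exp.2 (neg_le_neg (mul_le_mul_of_nonneg_left hab hβ))
    · refine mul_nonpos_of_nonneg_of_nonpos (sub_nonneg.2 hab) (sub_nonpos.2 ?_)
      exact Real.exp_le_exp.2 (neg_le_neg (mul_le_mul_of_nonneg_left hab hβ))
  have e : ∑ a ∈ s, ∑ b ∈ s, p a * p b * ((y a - y b) * (u a - u b)) =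
      ((∑ a ∈ s, p a * (y a * u a)) * ∑ b ∈ s, p b) -
      ((∑ a ∈ s, p a * y a) * ∑ b ∈ s, p b * u b) -
      ((∑ a ∈ s, p a * u a) * ∑ b ∈ s, p b * y b) +
      ((∑ a ∈ s, p a) * ∑ b ∈ s, p b * (y b * u b)) := by
    simp_rw [Finset.sum_mul_sum, ← Finset.sum_sub_distrib, ← Finset.sum_add_distrib]
    exact Finset.sum_congr rfl fun a _ => Finset.sum_congr rfl fun b _ => by ring
  rw [e] at h
  linarith [mul_comm (∑ a ∈ s, p a) (∑ a ∈ s, p a * (y a * u a)),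
    mul_comm (∑ a ∈ s, p a * y a) (∑ a ∈ s, p a * u a)]

variable [Fintype α] [Nonempty α]

/-- One step of multiplicative weights with rate `β` improves the expectation of `x` by the
symmetrized divergence over `β`. -/
lemma mul_sum_sub_mul_eq_symKL {p q x : α → ℝ} {β : ℝ} (hp : ∀ a, 0 < p a)
    (hp1 : ∑ a, p a = 1) (hq1 : ∑ a, q a = 1)
    (hq : ∀ a, q a = p a * Real.exp (β * x a) / ∑ b, p b * Real.exp (β * x b)) :
    β * ∑ a, (q a - p a) * x a = symKL q p := by
  set Z := ∑ b, p b * Real.exp (β * x b) with hZ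
  have hZ0 : 0 < Z := Finset.sum_pos (fun b _ => mul_pos (hp b) (Real.exp_pos _)) univ_nonempty
  have hlog : ∀ a, Real.log (q a) - Real.log (p a) = β * x a - Real.log Z := by
    intro a
    rw [hq a, Real.log_div (mul_pos (hp a) (Real.exp_pos _)).ne' hZ0.ne',
      Real.log_mul (hp a).ne' (Real.exp_pos _).ne', Real.log_exp]
    ring
  simp_rw [symKL, hlog, mul_sub, Finset.sum_sub_distrib, ← Finset.sum_mul,
    Finset.sum_sub_distrib, hp1, hq1, sub_self, zero_mul, sub_zero, Finset.mul_sum]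
  exact Finset.sum_congr rfl fun a _ => by ring

/-- If `x` has mean zero under `p`, one step of multiplicative weights with rate `β` raises its
mean to at least the fraction `c β δ / (1 + c β δ)` of its maximum `m`, where `c` bounds the mass
of the maximizers `B` from below and every other value is at most `m - δ`. -/
lemma mul_max_le_one_add_mul_sum {p q x : α → ℝ} {β c δ m : ℝ} (hp : ∀ a, 0 < p a)
    (hp1 : ∑ a, p a = 1) (hx : ∑ a, p a * x a = 0) (hβ : 0 < β) (hδ : 0 < δ)
    (hq : ∀ a, q a = p a * Real.exp (β * x a) / ∑ b, p b * Real.exp (β * x b))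
    (B : Finset α) (hB : ∀ a ∈ B, x a = m) (hBδ : ∀ a ∉ B, x a ≤ m - δ)
    (hc : c ≤ ∑ a ∈ B, p a) :
    c * β * δ * m ≤ (1 + c * β * δ) * ∑ a, q a * x a := by
  classical
  -- After the substitution `y = m - x`, the best actions have `y = 0` and the others `y ≥ δ`.
  set y : α → ℝ := fun a => m - x a with hy
  set u : α → ℝ := fun a => Real.exp (-(β * y a)) with hu
  set U := ∑ a, p a * u a with hU
  have hU0 : 0 < U := Finset.sum_pos (fun b _ => mul_pos (hp b) (Real.exp_pos _)) univ_nonempty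
  have hq' : ∀ a, q a = p a * u a / U := by
    intro a
    have hexp : ∀ b, Real.exp (β * x b) = Real.exp (β * m) * u b := by
      intro b; rw [hu, ← Real.exp_add]; congr 1; simp only [hy]; ring
    rw [hq a]
    simp_rw [hexp, mul_left_comm (p _), ← Finset.mul_sum]
    rw [mul_div_mul_left _ _ (Real.exp_pos _).ne']
  have hyB : ∀ a ∈ B, y a = 0 := fun a ha => by simp [hy, hB a ha]
  have hyN : ∀ a ∈ Bᶜ, δ ≤ y a := fun a ha => by
    have := hBδ a (by simpa using ha); simp only [hy]; linarith
  have hEy : ∑ a ∈ Bᶜ, p a * y a = m := by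
    have h1 : ∑ a, p a * y a = m := by
      simp_rw [hy, mul_sub, Finset.sum_sub_distrib, ← Finset.sum_mul, hp1, hx]; ring
    rw [← h1, ← Finset.sum_add_sum_compl B, Finset.sum_eq_zero (s := B)
      (fun a ha => by rw [hyB a ha, mul_zero]), zero_add]
  set W := ∑ a ∈ Bᶜ, p a * (y a * u a) with hW
  have hW0 : 0 ≤ W := Finset.sum_nonneg fun a ha =>
    mul_nonneg (hp a).le (mul_nonneg (hδ.le.trans (hyN a ha)) (Real.exp_pos _).le)
  have hUsplit : U = ∑ a ∈ B, p a + ∑ a ∈ Bᶜ, p a * u a := by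
    rw [hU, ← Finset.sum_add_sum_compl B]
    congr 1
    exact Finset.sum_congr rfl fun a ha => by simp [hu, hyB a ha]
  have hpN : ∑ a ∈ Bᶜ, p a = 1 - ∑ a ∈ B, p a := by
    rw [← hp1, ← Finset.sum_add_sum_compl B]; ring
  have hcheb := sum_mul_sum_exp_neg_le Bᶜ (y := y) (fun a => (hp a).le) hβ.le
  rw [hEy, hpN] at hcheb
  have hmW : (1 + β * δ) * W ≤ m := by
    rw [← hEy, hW, Finset.mul_sum]
    refine Finset.sum_le_sum fun a ha => ?_
    have h1 : (1 + β * δ) * u a ≤ 1 := by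
      have h2 : 1 + β * δ ≤ Real.exp (β * y a) := by
        have := Real.add_one_le_exp (β * y a)
        have := mul_le_mul_of_nonneg_left (hyN a ha) hβ.le
        linarith
      calc (1 + β * δ) * u a ≤ Real.exp (β * y a) * u a :=
            mul_le_mul_of_nonneg_right h2 (Real.exp_pos _).le
        _ = 1 := by rw [hu, ← Real.exp_add]; simp
    calc (1 + β * δ) * (p a * (y a * u a)) = p a * y a * ((1 + β * δ) * u a) := by ring
      _ ≤ p a * y a * 1 :=
        mul_le_mul_of_nonneg_left h1 (mul_nonneg (hp a).le (hδ.le.trans (hyN a ha)))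
      _ = p a * y a := mul_one _
  have hqx : ∑ a, q a * x a = m - W / U := by
    have h1 : ∑ a, q a * y a = W / U := by
      rw [← Finset.sum_add_sum_compl B, Finset.sum_eq_zero (s := B)
        (fun a ha => by rw [hyB a ha, mul_zero]), zero_add, hW, Finset.sum_div]
      exact Finset.sum_congr rfl fun a _ => by rw [hq' a]; ring
    have h2 : ∑ a, q a = 1 := by
      simp_rw [hq', ← Finset.sum_div]; exact div_self hU0.ne'
    rw [← h1]
    simp_rw [hy, mul_sub, Finset.sum_sub_distrib, ← Finset.sum_mul, h2]
    ring
  have hkey : (1 + c * β * δ) * W ≤ m * U := by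
    set P := ∑ a ∈ B, p a
    have hP : 0 ≤ P := Finset.sum_nonneg fun a _ => (hp a).le
    calc (1 + c * β * δ) * W ≤ (1 + P * β * δ) * W := by gcongr
      _ = P * ((1 + β * δ) * W) + (1 - P) * W := by ring
      _ ≤ P * m + m * ∑ a ∈ Bᶜ, p a * u a :=
        add_le_add (mul_le_mul_of_nonneg_left hmW hP) hcheb
      _ = m * U := by rw [hUsplit]; ring
  have hdiv : (1 + c * β * δ) * (W / U) ≤ m := by
    rw [← mul_div_assoc, div_le_iff₀ hU0]; exact hkey
  rw [hqx]
  linarith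

end MultiplicativeWeights

/-! ### Discounted sums: linearity, Bellman equation and bounds -/


namespace StochasticGame

variable {n : ℕ} {S : Type*} {A : Fin n → Type*}

lemma single_single_nonneg [DecidableEq S] [∀ i, DecidableEq (A i)]
    (s : S) (a : ∀ i, A i) :
    (0 : S → (∀ i, A i) → ℝ) ≤ Pi.single s (Pi.single a 1) :=
  Pi.single_nonneg.2 (Pi.single_nonneg.2 zero_le_one)

variable [∀ i, Fintype (A i)]

lemma jointProb_nonneg (π : JointPolicy S A) (s : S) (a : ∀ i, A i) : 0 ≤ jointProb π s a :=
  prod_nonneg fun i _ => (π i s).2.1 (a i)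

lemma sum_jointProb (π : JointPolicy S A) (s : S) : ∑ a, jointProb π s a = 1 :=
  sum_prod_eq_one (w := fun i => (π i s).1) fun i => (π i s).2.2

lemma startLaw_nonneg (π : JointPolicy S A) {μ : S → ℝ} (hμ : 0 ≤ μ) :
    0 ≤ startLaw π μ :=
  fun s a => mul_nonneg (hμ s) (jointProb_nonneg π s a)

variable [Fintype S]

/-- The integral of `f` against a weight `ν` on state-action pairs. -/
def pairing (ν f : S → (∀ i, A i) → ℝ) : ℝ :=
  ∑ s, ∑ a, ν s a * f s a

lemma pairing_startLaw (π : JointPolicy S A) (μ : S → ℝ) (f : S → (∀ i, A i) → ℝ) :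
    pairing (startLaw π μ) f = ∑ s, μ s * ∑ a, jointProb π s a * f s a := by
  simp only [pairing, startLaw, Finset.mul_sum, mul_assoc]

lemma pairing_startLaw_const (π : JointPolicy S A) (μ : S → ℝ) (v : S → ℝ) :
    pairing (startLaw π μ) (fun s _ => v s) = ∑ s, μ s * v s := by
  simp [pairing_startLaw, ← Finset.sum_mul, sum_jointProb]

lemma mass_startLaw (π : JointPolicy S A) (μ : S → ℝ) :
    pairing (startLaw π μ) (fun _ _ => 1) = ∑ s, μ s := by
  simpa using pairing_startLaw_const π μ (fun _ => 1)

lemma pairing_mono {ν f g : S → (∀ i, A i) → ℝ} (hν : 0 ≤ ν) (h : ∀ s a, f s a ≤ g s a) :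
    pairing ν f ≤ pairing ν g :=
  Finset.sum_le_sum fun s _ => Finset.sum_le_sum fun a _ =>
    mul_le_mul_of_nonneg_left (h s a) (hν s a)

lemma pairing_nonneg {ν f : S → (∀ i, A i) → ℝ} (hν : 0 ≤ ν) (h : ∀ s a, 0 ≤ f s a) :
    0 ≤ pairing ν f :=
  Finset.sum_nonneg fun s _ => Finset.sum_nonneg fun a _ => mul_nonneg (hν s a) (h s a)

lemma pairing_const (ν : S → (∀ i, A i) → ℝ) (c : ℝ) :
    pairing ν (fun _ _ => c) = c * pairing ν (fun _ _ => 1) := by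
  simp only [pairing, mul_one, Finset.sum_mul, mul_comm c]

/-- Integration against a mixture of laws. -/
lemma pairing_comm (ν g : S → (∀ i, A i) → ℝ) (k : S → (∀ i, A i) → S → (∀ i, A i) → ℝ) :
    pairing (fun y v => pairing ν fun x u => k x u y v) g =
      pairing ν fun x u => pairing (k x u) g := by
  simp only [pairing, Finset.sum_mul, Finset.mul_sum, mul_assoc]
  simp_rw [← Fintype.sum_prod_type']
  calc _ = ∑ x : S × (∀ i, A i), ∑ y : S × (∀ i, A i),
        ν x.1 x.2 * (k x.1 x.2 y.1 y.2 * g y.1 y.2) := by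
        rw [Finset.sum_comm]
        simp only [Fintype.sum_prod_type]
    _ = _ := by simp only [Fintype.sum_prod_type]

lemma γ_nonneg (G : StochasticGame n S A) : 0 ≤ G.γ := G.γ_mem.1.le

lemma one_sub_γ_pos (G : StochasticGame n S A) : 0 < 1 - G.γ := sub_pos.2 G.γ_mem.2

lemma pairLaw_nonneg (G : StochasticGame n S A) (π : JointPolicy S A)
    {ν : S → (∀ i, A i) → ℝ} (hν : 0 ≤ ν) (t : ℕ) : 0 ≤ G.pairLaw π ν t := by
  induction t with
  | zero => exact hν
  | succ t ih =>
    exact fun s' a' => mul_nonneg (Finset.sum_nonneg fun s _ => Finset.sum_nonneg fun a _ =>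
      mul_nonneg (ih s a) ((G.P s a).2.1 s')) (jointProb_nonneg π s' a')

lemma pairLaw_succ (G : StochasticGame n S A) (π : JointPolicy S A)
    (ν : S → (∀ i, A i) → ℝ) (t : ℕ) :
    G.pairLaw π ν (t + 1) =
      startLaw π (fun s' => pairing (G.pairLaw π ν t) fun s a => (G.P s a).1 s') := rfl

lemma pairLaw_one_pairLaw (G : StochasticGame n S A) (π : JointPolicy S A)
    (ν : S → (∀ i, A i) → ℝ) (t : ℕ) :
    G.pairLaw π (G.pairLaw π ν 1) t = G.pairLaw π ν (t + 1) := by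
  induction t with
  | zero => rfl
  | succ t ih => rw [pairLaw_succ, ih, ← pairLaw_succ]

/-- One more step of the chain integrates a function of the state against the kernel. -/
lemma pairing_pairLaw_succ (G : StochasticGame n S A) (π : JointPolicy S A)
    (ν : S → (∀ i, A i) → ℝ) (t : ℕ) (v : S → ℝ) :
    pairing (G.pairLaw π ν (t + 1)) (fun s _ => v s) =
      pairing (G.pairLaw π ν t) (fun s a => ∑ s', (G.P s a).1 s' * v s') := by
  rw [pairLaw_succ, pairing_startLaw_const]
  simp only [pairing, Finset.mul_sum, Finset.sum_mul]
  rw [Finset.sum_comm]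
  refine Finset.sum_congr rfl fun s _ => ?_
  rw [Finset.sum_comm]
  exact Finset.sum_congr rfl fun a _ => Finset.sum_congr rfl fun s' _ => by ring

lemma mass_pairLaw (G : StochasticGame n S A) (π : JointPolicy S A)
    (ν : S → (∀ i, A i) → ℝ) (t : ℕ) :
    pairing (G.pairLaw π ν t) (fun _ _ => 1) = pairing ν (fun _ _ => 1) := by
  induction t with
  | zero => rfl
  | succ t ih =>
    rw [pairing_pairLaw_succ G π ν t (fun _ => 1), ← ih]
    congr 1
    funext s a
    simpa using (G.P s a).2.2

lemma abs_pairing_le {ν f : S → (∀ i, A i) → ℝ} (hν : 0 ≤ ν) {R : ℝ}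
    (hf : ∀ s a, |f s a| ≤ R) : |pairing ν f| ≤ R * pairing ν (fun _ _ => 1) := by
  rw [← pairing_const, abs_le]
  refine ⟨?_, pairing_mono hν fun s a => (le_abs_self _).trans (hf s a)⟩
  have : -pairing ν (fun _ _ => R) = pairing ν (fun _ _ => -R) := by simp [pairing]
  rw [this]
  exact pairing_mono hν fun s a => neg_le_of_abs_le (hf s a)

lemma summable_discounted (G : StochasticGame n S A) (π : JointPolicy S A)
    {ν : S → (∀ i, A i) → ℝ} (hν : 0 ≤ ν) (f : S → (∀ i, A i) → ℝ) :
    Summable fun t : ℕ => G.γ ^ t * pairing (G.pairLaw π ν t) f := by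
  have hf : ∀ s a, |f s a| ≤ ∑ s, ∑ a, |f s a| := fun s a =>
    (Finset.single_le_sum (f := fun a => |f s a|) (fun _ _ => abs_nonneg _)
      (mem_univ a)).trans
    (Finset.single_le_sum (f := fun s => ∑ a, |f s a|)
      (fun _ _ => Finset.sum_nonneg fun _ _ => abs_nonneg _) (mem_univ s))
  refine Summable.of_norm_bounded ((summable_geometric_of_lt_one G.γ_nonneg
    G.γ_mem.2).mul_right ((∑ s, ∑ a, |f s a|) * pairing ν (fun _ _ => 1))) fun t => ?_
  rw [Real.norm_eq_abs, abs_mul, abs_of_nonneg (pow_nonneg G.γ_nonneg t)]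
  refine mul_le_mul_of_nonneg_left ?_ (pow_nonneg G.γ_nonneg t)
  rw [← G.mass_pairLaw π ν t]
  exact abs_pairing_le (G.pairLaw_nonneg π hν t) hf

lemma discounted_sub (G : StochasticGame n S A) (π : JointPolicy S A)
    {ν : S → (∀ i, A i) → ℝ} (hν : 0 ≤ ν) (f g : S → (∀ i, A i) → ℝ) :
    G.discounted π ν (fun s a => f s a - g s a) =
      G.discounted π ν f - G.discounted π ν g := by
  unfold discounted
  refine Eq.trans ?_ ((G.summable_discounted π hν f).tsum_sub (G.summable_discounted π hν g))
  refine tsum_congr fun t => ?_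
  simp only [pairing, mul_sub, Finset.sum_sub_distrib]

lemma discounted_add (G : StochasticGame n S A) (π : JointPolicy S A)
    {ν : S → (∀ i, A i) → ℝ} (hν : 0 ≤ ν) (f g : S → (∀ i, A i) → ℝ) :
    G.discounted π ν (fun s a => f s a + g s a) =
      G.discounted π ν f + G.discounted π ν g := by
  unfold discounted
  refine Eq.trans ?_ ((G.summable_discounted π hν f).tsum_add (G.summable_discounted π hν g))
  refine tsum_congr fun t => ?_
  simp only [pairing, mul_add, Finset.sum_add_distrib]

lemma discounted_const_mul (G : StochasticGame n S A) (π : JointPolicy S A)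
    (ν : S → (∀ i, A i) → ℝ) (c : ℝ) (f : S → (∀ i, A i) → ℝ) :
    G.discounted π ν (fun s a => c * f s a) = c * G.discounted π ν f := by
  unfold discounted
  rw [← tsum_mul_left]
  refine tsum_congr fun t => ?_
  simp only [Finset.mul_sum]
  exact Finset.sum_congr rfl fun s _ => Finset.sum_congr rfl fun a _ => by ring

lemma discounted_nonneg (G : StochasticGame n S A) (π : JointPolicy S A)
    {ν : S → (∀ i, A i) → ℝ} (hν : 0 ≤ ν) {f : S → (∀ i, A i) → ℝ} (hf : ∀ s a, 0 ≤ f s a) :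
    0 ≤ G.discounted π ν f :=
  tsum_nonneg fun t => mul_nonneg (pow_nonneg G.γ_nonneg t)
    (pairing_nonneg (G.pairLaw_nonneg π hν t) hf)

lemma discounted_le (G : StochasticGame n S A) (π : JointPolicy S A)
    {ν : S → (∀ i, A i) → ℝ} (hν : 0 ≤ ν) (hν1 : pairing ν (fun _ _ => 1) = 1)
    {f : S → (∀ i, A i) → ℝ} {R : ℝ} (hf : ∀ s a, f s a ≤ R) :
    G.discounted π ν f ≤ R / (1 - G.γ) := by
  rw [div_eq_inv_mul, ← tsum_geometric_of_lt_one G.γ_nonneg G.γ_mem.2, ← tsum_mul_right]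
  refine Summable.tsum_le_tsum (fun t => ?_) (G.summable_discounted π hν f)
    ((summable_geometric_of_lt_one G.γ_nonneg G.γ_mem.2).mul_right R)
  refine mul_le_mul_of_nonneg_left ?_ (pow_nonneg G.γ_nonneg t)
  have := pairing_mono (G.pairLaw_nonneg π hν t) hf
  rwa [pairing_const, mass_pairLaw, hν1, mul_one] at this

lemma discounted_eq_add (G : StochasticGame n S A) (π : JointPolicy S A)
    {ν : S → (∀ i, A i) → ℝ} (hν : 0 ≤ ν) (f : S → (∀ i, A i) → ℝ) :
    G.discounted π ν f = pairing ν f + G.γ * G.discounted π (G.pairLaw π ν 1) f := by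
  unfold discounted
  refine ((G.summable_discounted π hν f).tsum_eq_zero_add).trans ?_
  rw [← tsum_mul_left]
  congr 1
  · simp [pairLaw]
  · refine tsum_congr fun t => ?_
    rw [pairLaw_one_pairLaw, pow_succ']
    simp only [pairing, mul_assoc]

/-- The discounted sum of the expected next-state value telescopes. -/
lemma γ_mul_discounted_kernel (G : StochasticGame n S A) (π : JointPolicy S A)
    {ν : S → (∀ i, A i) → ℝ} (hν : 0 ≤ ν) (v : S → ℝ) :
    G.γ * G.discounted π ν (fun s a => ∑ s', (G.P s a).1 s' * v s') =
      G.discounted π ν (fun s _ => v s) - pairing ν (fun s _ => v s) := by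
  rw [G.discounted_eq_add π hν (fun s _ => v s), add_sub_cancel_left]
  congr 1
  refine tsum_congr fun t => ?_
  rw [pairLaw_one_pairLaw]
  exact congrArg _ (G.pairing_pairLaw_succ π ν t v).symm

/-! ### Discounted occupation of the states -/

variable [DecidableEq S]

/-- The expected discounted number of visits to `s` when the initial state has law `μ`. -/
def occupation (G : StochasticGame n S A) (π : JointPolicy S A) (μ : S → ℝ) (s : S) : ℝ :=
  G.discounted π (startLaw π μ) fun s' _ => if s' = s then 1 else 0

lemma discounted_startLaw_eq_sum_occupation (G : StochasticGame n S A) (π : JointPolicy S A)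
    {μ : S → ℝ} (hμ : 0 ≤ μ) (g : S → (∀ i, A i) → ℝ) :
    G.discounted π (startLaw π μ) g =
      ∑ s, G.occupation π μ s * ∑ a, jointProb π s a * g s a := by
  -- At each time the law of the state-action pair is some state law followed by `π`.
  have hlaw : ∀ t, ∃ m, G.pairLaw π (startLaw π μ) t = startLaw π m := by
    rintro (_ | t)
    · exact ⟨μ, rfl⟩
    · exact ⟨_, G.pairLaw_succ π _ t⟩
  have h : ∀ t, G.γ ^ t * pairing (G.pairLaw π (startLaw π μ) t) g =
      ∑ s, (G.γ ^ t * pairing (G.pairLaw π (startLaw π μ) t)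
        fun s' _ => if s' = s then 1 else 0) * ∑ a, jointProb π s a * g s a := by
    intro t
    obtain ⟨m, hm⟩ := hlaw t
    rw [hm, pairing_startLaw, Finset.mul_sum]
    refine Finset.sum_congr rfl fun s _ => ?_
    rw [pairing_startLaw_const π m (fun s' => if s' = s then 1 else 0)]
    simp [mul_assoc]
  refine (tsum_congr h).trans ?_
  rw [Summable.tsum_finsetSum fun s _ =>
    (G.summable_discounted π (startLaw_nonneg π hμ) _).mul_right _]
  exact Finset.sum_congr rfl fun s _ => tsum_mul_right

lemma occupation_nonneg (G : StochasticGame n S A) (π : JointPolicy S A) {μ : S → ℝ}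
    (hμ : 0 ≤ μ) (s : S) : 0 ≤ G.occupation π μ s :=
  G.discounted_nonneg π (startLaw_nonneg π hμ) fun s' _ => by split_ifs <;> norm_num

lemma occupation_le (G : StochasticGame n S A) (π : JointPolicy S A) (s : S) :
    G.occupation π G.ρ.1 s ≤ 1 / (1 - G.γ) :=
  G.discounted_le π (startLaw_nonneg π G.ρ.2.1) ((mass_startLaw π _).trans G.ρ.2.2)
    fun s' _ => by split_ifs <;> norm_num

lemma one_le_occupation_single (G : StochasticGame n S A) (π : JointPolicy S A) (s : S) :
    1 ≤ G.occupation π (Pi.single s 1) s := by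
  have h0 : (0 : S → ℝ) ≤ Pi.single s 1 := Pi.single_nonneg.2 zero_le_one
  have hf : ∀ (s' : S) (_ : ∀ i, A i), (0 : ℝ) ≤ if s' = s then 1 else 0 :=
    fun s' _ => by split_ifs <;> norm_num
  rw [occupation, G.discounted_eq_add π (startLaw_nonneg π h0),
    pairing_startLaw_const π _ (fun s' => if s' = s then 1 else 0)]
  have := mul_nonneg G.γ_nonneg (G.discounted_nonneg π
    (G.pairLaw_nonneg π (startLaw_nonneg π h0) 1) hf)
  simpa using this

lemma visitation_eq (G : StochasticGame n S A) (π : JointPolicy S A) (s : S) :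
    G.visitation π s = (1 - G.γ) * G.occupation π G.ρ.1 s := rfl

/-- A finite mismatch coefficient excludes states that are never visited, since these contribute
`0⁻¹ = ∞`. -/
lemma one_le_mismatch_mul_visitation (G : StochasticGame n S A) (hM : G.mismatch ≠ ⊤)
    (π : JointPolicy S A) (s : S) : 1 ≤ G.mismatch.toReal * G.visitation π s := by
  have h : (ENNReal.ofReal (G.visitation π s))⁻¹ ≤ G.mismatch :=
    le_iSup₂_of_le (f := fun π s => (ENNReal.ofReal (G.visitation π s))⁻¹) π s le_rfl
  have hpos : 0 < G.visitation π s := by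
    by_contra hneg
    rw [ENNReal.ofReal_of_nonpos (not_lt.1 hneg), ENNReal.inv_zero, top_le_iff] at h
    exact hM h
  rw [← ENNReal.ofReal_inv_of_pos hpos, ENNReal.ofReal_le_iff_le_toReal hM] at h
  rwa [inv_le_iff_one_le_mul₀ hpos] at h

/-! ### Values, action values and the performance difference formula -/

variable [∀ i, DecidableEq (A i)]

lemma pairing_single_single (s : S) (a : ∀ i, A i) (f : S → (∀ i, A i) → ℝ) :
    pairing (Pi.single s (Pi.single a 1)) f = f s a := by
  rw [pairing, Finset.sum_eq_single s, Finset.sum_eq_single a] <;>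
    simp +contextual [Pi.single_apply]

lemma pairLaw_eq_pairing (G : StochasticGame n S A) (π : JointPolicy S A)
    (ν : S → (∀ i, A i) → ℝ) (t : ℕ) :
    G.pairLaw π ν t = fun s' a' =>
      pairing ν fun s a => G.pairLaw π (Pi.single s (Pi.single a 1)) t s' a' := by
  induction t with
  | zero =>
    funext s' a'
    simp only [pairLaw, pairing]
    rw [Finset.sum_eq_single s', Finset.sum_eq_single a'] <;>
      simp +contextual [Pi.single_apply, eq_comm]
  | succ t ih =>
    funext s' a'
    simp only [pairLaw_succ, startLaw]
    rw [ih, pairing_comm]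
    simp only [pairing, Finset.sum_mul, mul_assoc]

/-- A discounted sum is the integral of the action values against the initial law. -/
lemma discounted_eq_pairing_qValue (G : StochasticGame n S A) (π : JointPolicy S A)
    (ν f : S → (∀ i, A i) → ℝ) :
    G.discounted π ν f = pairing ν (G.qValue f π) := by
  have h : ∀ t, G.γ ^ t * pairing (G.pairLaw π ν t) f = ∑ x, ∑ u, ν x u *
      (G.γ ^ t * pairing (G.pairLaw π (Pi.single x (Pi.single u 1)) t) f) := by
    intro t
    rw [pairLaw_eq_pairing, pairing_comm, pairing]
    simp only [Finset.mul_sum, mul_left_comm]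
  refine (tsum_congr h).trans ?_
  have hs : ∀ x u, Summable fun t : ℕ => ν x u *
      (G.γ ^ t * pairing (G.pairLaw π (Pi.single x (Pi.single u 1)) t) f) := fun x u =>
    (G.summable_discounted π (single_single_nonneg x u) f).mul_left _
  rw [Summable.tsum_finsetSum fun x _ => summable_sum fun u _ => hs x u]
  refine Finset.sum_congr rfl fun x _ => ?_
  rw [Summable.tsum_finsetSum fun u _ => hs x u]
  exact Finset.sum_congr rfl fun u _ => tsum_mul_left

lemma value_eq_sum (G : StochasticGame n S A) (f : S → (∀ i, A i) → ℝ) (π : JointPolicy S A)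
    (s : S) : G.value f π s = ∑ a, jointProb π s a * G.qValue f π s a := by
  rw [value, discounted_eq_pairing_qValue, pairing_startLaw, Finset.sum_eq_single s] <;>
    simp +contextual

lemma discounted_startLaw_eq_sum_value (G : StochasticGame n S A) (π : JointPolicy S A)
    (μ : S → ℝ) (f : S → (∀ i, A i) → ℝ) :
    G.discounted π (startLaw π μ) f = ∑ s, μ s * G.value f π s := by
  simp_rw [discounted_eq_pairing_qValue, pairing_startLaw, value_eq_sum]

lemma valueInit_eq_discounted (G : StochasticGame n S A) (f : S → (∀ i, A i) → ℝ)
    (π : JointPolicy S A) : G.valueInit f π = G.discounted π (startLaw π G.ρ.1) f :=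
  (G.discounted_startLaw_eq_sum_value π _ f).symm

lemma qValue_eq_bellman (G : StochasticGame n S A) (f : S → (∀ i, A i) → ℝ)
    (π : JointPolicy S A) (s : S) (a : ∀ i, A i) :
    G.qValue f π s a = f s a + G.γ * ∑ s', (G.P s a).1 s' * G.value f π s' := by
  rw [qValue, G.discounted_eq_add π (single_single_nonneg s a), pairing_single_single,
    pairLaw_succ, discounted_startLaw_eq_sum_value]
  simp only [pairLaw, pairing_single_single]

/-- The advantage `Q_f^π - V_f^π` of a joint action, for an arbitrary reward function `f`. -/
def adv (G : StochasticGame n S A) (f : S → (∀ i, A i) → ℝ) (π : JointPolicy S A) (s : S)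
    (a : ∀ i, A i) : ℝ :=
  G.qValue f π s a - G.value f π s

lemma sum_jointProb_mul_adv (G : StochasticGame n S A) (f : S → (∀ i, A i) → ℝ)
    (π : JointPolicy S A) (s : S) : ∑ a, jointProb π s a * G.adv f π s a = 0 := by
  simp_rw [adv, mul_sub, Finset.sum_sub_distrib, ← Finset.sum_mul, sum_jointProb, value_eq_sum]
  ring

/-- The performance difference formula: the gain of `π'` over `π` is the advantage of `π`
collected along `π'`. -/
lemma sum_value_sub_sum_value (G : StochasticGame n S A) (f : S → (∀ i, A i) → ℝ)
    (π π' : JointPolicy S A) {μ : S → ℝ} (hμ : 0 ≤ μ) :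
    ∑ s, μ s * G.value f π' s - ∑ s, μ s * G.value f π s =
      ∑ s, G.occupation π' μ s * ∑ a, jointProb π' s a * G.adv f π s a := by
  have hν := startLaw_nonneg π' hμ
  rw [← G.discounted_startLaw_eq_sum_occupation π' hμ]
  unfold adv
  simp_rw [qValue_eq_bellman]
  rw [G.discounted_sub π' hν, G.discounted_add π' hν, G.discounted_const_mul,
    G.γ_mul_discounted_kernel π' hν, pairing_startLaw_const,
    ← discounted_startLaw_eq_sum_value]
  ring

lemma value_sub_value (G : StochasticGame n S A) (f : S → (∀ i, A i) → ℝ)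
    (π π' : JointPolicy S A) (s : S) :
    G.value f π' s - G.value f π s =
      ∑ s', G.occupation π' (Pi.single s 1) s' * ∑ a, jointProb π' s' a * G.adv f π s' a := by
  rw [← G.sum_value_sub_sum_value f π π' (Pi.single_nonneg.2 zero_le_one)]
  simp [Pi.single_apply]

lemma valueInit_sub_valueInit (G : StochasticGame n S A) (f : S → (∀ i, A i) → ℝ)
    (π π' : JointPolicy S A) :
    G.valueInit f π' - G.valueInit f π =
      ∑ s, G.occupation π' G.ρ.1 s * ∑ a, jointProb π' s a * G.adv f π s a :=
  G.sum_value_sub_sum_value f π π' G.ρ.2.1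

lemma valueInit_mem_Icc (G : StochasticGame n S A) (π : JointPolicy S A)
    {f : S → (∀ i, A i) → ℝ} {R : ℝ} (hf : ∀ s a, 0 ≤ f s a ∧ f s a ≤ R) :
    G.valueInit f π ∈ Set.Icc 0 (R / (1 - G.γ)) := by
  rw [valueInit_eq_discounted]
  exact ⟨G.discounted_nonneg π (startLaw_nonneg π G.ρ.2.1) fun s a => (hf s a).1,
    G.discounted_le π (startLaw_nonneg π G.ρ.2.1) ((mass_startLaw π _).trans G.ρ.2.2)
      fun s a => (hf s a).2⟩

lemma abs_adv_le (G : StochasticGame n S A) (π : JointPolicy S A)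
    {f : S → (∀ i, A i) → ℝ} {R : ℝ} (hf : ∀ s a, 0 ≤ f s a ∧ f s a ≤ R) (s : S)
    (a : ∀ i, A i) : |G.adv f π s a| ≤ R / (1 - G.γ) := by
  have h0 : (0 : S → ℝ) ≤ Pi.single s 1 := Pi.single_nonneg.2 zero_le_one
  have q0 : 0 ≤ G.qValue f π s a :=
    G.discounted_nonneg π (single_single_nonneg s a) fun s a => (hf s a).1
  have q1 : G.qValue f π s a ≤ R / (1 - G.γ) :=
    G.discounted_le π (single_single_nonneg s a) (pairing_single_single s a _)
      fun s a => (hf s a).2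
  have v0 : 0 ≤ G.value f π s :=
    G.discounted_nonneg π (startLaw_nonneg π h0) fun s a => (hf s a).1
  have v1 : G.value f π s ≤ R / (1 - G.γ) :=
    G.discounted_le π (startLaw_nonneg π h0) ((mass_startLaw π _).trans (by simp))
      fun s a => (hf s a).2
  rw [adv, abs_le]
  constructor <;> linarith

end StochasticGame

namespace StochasticGame

/-! ### Unilateral deviations and the potential -/

variable {n : ℕ} {S : Type*} {A : Fin n → Type*} [∀ i, Fintype (A i)]
  [∀ i, DecidableEq (A i)]

lemma sum_jointProb_update (π : JointPolicy S A) (i : Fin n) (τ : LocalPolicy S (A i)) (s : S)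
    (F : (∀ i, A i) → ℝ) :
    ∑ a, jointProb (Function.update π i τ) s a * F a =
      ∑ b, (τ s).1 b * marginal (fun j => (π j s).1) F i b := by
  refine (sum_prod_mul_eq_sum_marginal
    (fun j => (Function.update π i τ j s).1) F i).trans ?_
  refine Finset.sum_congr rfl fun b _ => ?_
  rw [marginal_congr (w' := fun j => (π j s).1) fun j hj => by rw [Function.update_of_ne hj],
    Function.update_self]

variable [Fintype S] [DecidableEq S]

lemma sum_mul_marginal_adv (G : StochasticGame n S A) (f : S → (∀ i, A i) → ℝ)
    (π : JointPolicy S A) (s : S) (i : Fin n) :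
    ∑ b, (π i s).1 b * marginal (fun j => (π j s).1) (G.adv f π s) i b = 0 := by
  rw [← sum_prod_mul_eq_sum_marginal (fun j => (π j s).1)]
  exact G.sum_jointProb_mul_adv f π s

lemma sum_mul_margAdvantage (G : StochasticGame n S A) (π : JointPolicy S A) (s : S)
    (i : Fin n) : ∑ b, (π i s).1 b * G.margAdvantage i π s b = 0 :=
  G.sum_mul_marginal_adv (G.r i) π s i

/-- When agent `i` switches to the pure action `b` in the single state `s`, the value at `s`
changes by a positive multiple of the marginalized advantage of `b`. -/
lemma value_update_single_sub_value (G : StochasticGame n S A) (f : S → (∀ i, A i) → ℝ)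
    (π : JointPolicy S A) (i : Fin n) (s : S) (b : A i) (e : stdSimplex ℝ (A i))
    (he : e.1 = Pi.single b 1) :
    G.value f (Function.update π i (Function.update (π i) s e)) s - G.value f π s =
      G.occupation (Function.update π i (Function.update (π i) s e)) (Pi.single s 1) s *
        marginal (fun j => (π j s).1) (G.adv f π s) i b := by
  rw [value_sub_value]
  simp_rw [sum_jointProb_update]
  rw [Finset.sum_eq_single s]
  · rw [Function.update_self, he]
    simp [Pi.single_apply]
  · intro s' _ hs'
    rw [Function.update_of_ne hs', sum_mul_marginal_adv, mul_zero]
  · simp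

/-- In a potential game the marginalized advantages of the rewards are those of the potential:
compare the two under a deviation to a pure action in a single state. -/
lemma IsPotential.margAdvantage_eq {G : StochasticGame n S A} {φ : S → (∀ i, A i) → ℝ}
    (hφ : G.IsPotential φ) (i : Fin n) (π : JointPolicy S A) (s : S) (b : A i) :
    G.margAdvantage i π s b = marginal (fun j => (π j s).1) (G.adv φ π s) i b := by
  let e : stdSimplex ℝ (A i) := ⟨Pi.single b 1, single_mem_stdSimplex ℝ b⟩
  have h := hφ i s π (Function.update (π i) s e)
  rw [G.value_update_single_sub_value _ π i s b e rfl,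
    G.value_update_single_sub_value _ π i s b e rfl] at h
  exact mul_left_cancel₀ (zero_lt_one.trans_le (G.one_le_occupation_single _ s)).ne' h

lemma valueInit_update_sub (G : StochasticGame n S A) (π : JointPolicy S A) (i : Fin n)
    (τ : LocalPolicy S (A i)) :
    G.valueInit (G.r i) (Function.update π i τ) - G.valueInit (G.r i) π =
      ∑ s, G.occupation (Function.update π i τ) G.ρ.1 s *
        ∑ b, (τ s).1 b * G.margAdvantage i π s b := by
  rw [valueInit_sub_valueInit]
  simp_rw [sum_jointProb_update]
  rfl

/-! ### One step of natural policy gradient -/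

/-- The sum over the agents of the expectations `𝔼_{π'_i(·|s)}[Ā_i^π(s, ·)]`, weighted by the
discounted (not normalized) occupation of the states `s` under `π'`: the first-order part of the
change of potential from `π` to `π'`. -/
def stepGain (G : StochasticGame n S A) (π π' : JointPolicy S A) : ℝ :=
  ∑ s, G.occupation π' G.ρ.1 s * ∑ i, ∑ b, (π' i s).1 b * G.margAdvantage i π s b

/-- For a small enough step size, the potential grows by at least half of its first-order
change. -/
lemma half_stepGain_le {G : StochasticGame n S A} {φ : S → (∀ i, A i) → ℝ}
    (hφ : G.IsPotential φ) {φmax : ℝ} (hφmax : 0 ≤ φmax)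
    (hbound : ∀ s a, 0 ≤ φ s a ∧ φ s a ≤ φmax) {π π' : JointPolicy S A}
    (hπ : ∀ i s a, 0 < (π i s).1 a) (hπ' : ∀ i s a, 0 < (π' i s).1 a) {β : ℝ}
    (hβ0 : 0 < β) (hβ : √n * (φmax / (1 - G.γ)) * β ≤ 1 / 2)
    (hstep : ∀ i s a, (π' i s).1 a = (π i s).1 a * Real.exp (β * G.margAdvantage i π s a) /
      ∑ b, (π i s).1 b * Real.exp (β * G.margAdvantage i π s b)) :
    1 / 2 * G.stepGain π π' ≤ G.valueInit φ π' - G.valueInit φ π := by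
  rw [valueInit_sub_valueInit, stepGain, Finset.mul_sum]
  refine Finset.sum_le_sum fun s _ => ?_
  rw [mul_left_comm]
  refine mul_le_mul_of_nonneg_left ?_ (G.occupation_nonneg π' G.ρ.2.1 s)
  have hne : ∀ i, Nonempty (A i) := fun i => by
    by_contra h
    rw [not_nonempty_iff] at h
    simpa using (π i s).2.2
  have h := abs_sum_prod_sub_le (fun i => hπ i s) (fun i => hπ' i s) (fun i => (π i s).2.2)
    (fun i => (π' i s).2.2) (G.abs_adv_le π hbound s)
    (div_nonneg hφmax G.one_sub_γ_pos.le)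
  have hsym : ∀ i, symKL (π' i s).1 (π i s).1 =
      β * ∑ b, (π' i s).1 b * G.margAdvantage i π s b := by
    intro i
    have := hne i
    rw [← mul_sum_sub_mul_eq_symKL (hπ i s) (π i s).2.2 (π' i s).2.2 (hstep i s)]
    simp_rw [sub_mul, Finset.sum_sub_distrib, G.sum_mul_margAdvantage, sub_zero]
  have hlin : ∀ i, ∑ b, ((π' i s).1 b - (π i s).1 b) *
      marginal (fun j => (π j s).1) (G.adv φ π s) i b =
      ∑ b, (π' i s).1 b * G.margAdvantage i π s b := by
    intro i
    simp_rw [sub_mul, Finset.sum_sub_distrib, sum_mul_marginal_adv, sub_zero,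
      hφ.margAdvantage_eq]
  have h0 : ∑ a, (∏ j, (π j s).1 (a j)) * G.adv φ π s a = 0 :=
    G.sum_jointProb_mul_adv φ π s
  simp_rw [hlin, hsym, ← Finset.mul_sum] at h
  rw [h0, sub_zero] at h
  set X := ∑ i, ∑ b, (π' i s).1 b * G.margAdvantage i π s b with hX
  have hJ : 0 ≤ β * X := by
    rw [hX, Finset.mul_sum]
    simp_rw [← hsym]
    exact Finset.sum_nonneg fun i _ => symKL_nonneg (hπ' i s) (hπ i s)
  have hX0 : √n * (φmax / (1 - G.γ)) * (β * X) ≤ 1 / 2 * X := by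
    rw [← mul_assoc]
    exact mul_le_mul_of_nonneg_right hβ (nonneg_of_mul_nonneg_right hJ hβ0)
  have h1 := (abs_le.1 h).1
  have h2 : ∑ a, jointProb π' s a * G.adv φ π s a =
      ∑ a, (∏ j, (π' j s).1 (a j)) * G.adv φ π s a := rfl
  rw [h2]
  linarith

/-- The gain of any unilateral deviation is at most the mismatch coefficient times the visited
maximal marginalized advantages, and these are controlled by the gain of the step. -/
lemma neGap_le [NeZero n] (G : StochasticGame n S A) {π π' : JointPolicy S A} {M t : ℝ}
    (hM0 : 0 ≤ M) (hM : ∀ s, 1 ≤ M * G.visitation π' s) (m : Fin n → S → ℝ)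
    (hm : ∀ i s b, G.margAdvantage i π s b ≤ m i s)
    (hmt : ∀ i s, m i s ≤ (1 + t) * ∑ b, (π' i s).1 b * G.margAdvantage i π s b) :
    G.neGap π ≤ M * (1 + t) * G.stepGain π π' := by
  have havg : ∀ (i : Fin n) s (p : stdSimplex ℝ (A i)),
      ∑ b, p.1 b * G.margAdvantage i π s b ≤ m i s := by
    intro i s p
    calc ∑ b, p.1 b * G.margAdvantage i π s b ≤ ∑ b, p.1 b * m i s :=
          Finset.sum_le_sum fun b _ => mul_le_mul_of_nonneg_left (hm i s b) (p.2.1 b)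
      _ = m i s := by rw [← Finset.sum_mul, p.2.2, one_mul]
  have hm0 : ∀ i s, 0 ≤ m i s := fun i s =>
    (G.sum_mul_margAdvantage π s i).symm.le.trans (havg i s (π i s))
  have hγ := G.one_sub_γ_pos
  refine ciSup_le fun i => ?_
  have : Nonempty (LocalPolicy S (A i)) := ⟨π i⟩
  refine ciSup_le fun τ => ?_
  rw [valueInit_update_sub, stepGain, Finset.mul_sum]
  refine Finset.sum_le_sum fun s _ => ?_
  have hocc : 1 / (1 - G.γ) ≤ M * G.occupation π' G.ρ.1 s := by
    rw [div_le_iff₀ hγ]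
    have := hM s
    rw [visitation_eq] at this
    linarith
  have hocc0 : 0 ≤ M * G.occupation π' G.ρ.1 s :=
    mul_nonneg hM0 (G.occupation_nonneg π' G.ρ.2.1 s)
  calc G.occupation (Function.update π i τ) G.ρ.1 s * ∑ b, (τ s).1 b * G.margAdvantage i π s b
      ≤ G.occupation (Function.update π i τ) G.ρ.1 s * m i s :=
        mul_le_mul_of_nonneg_left (havg i s (τ s)) (G.occupation_nonneg _ G.ρ.2.1 s)
    _ ≤ M * G.occupation π' G.ρ.1 s * m i s :=
        mul_le_mul_of_nonneg_right ((G.occupation_le _ s).trans hocc) (hm0 i s)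
    _ ≤ M * G.occupation π' G.ρ.1 s * ∑ j, m j s :=
        mul_le_mul_of_nonneg_left
          (Finset.single_le_sum (f := fun j => m j s) (fun j _ => hm0 j s) (mem_univ i)) hocc0
    _ ≤ M * G.occupation π' G.ρ.1 s *
          ((1 + t) * ∑ j, ∑ b, (π' j s).1 b * G.margAdvantage j π s b) := by
        rw [Finset.mul_sum (a := 1 + t)]
        exact mul_le_mul_of_nonneg_left (Finset.sum_le_sum fun j _ => hmt j s) hocc0
    _ = _ := by ring

/-! ### Best actions -/

lemma exists_mem_bestActions (G : StochasticGame n S A) (π : JointPolicy S A) (i : Fin n)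
    (s : S) : ∃ a, a ∈ G.bestActions π i s := by
  have : Nonempty (A i) := by
    by_contra h
    rw [not_nonempty_iff] at h
    simpa using (π i s).2.2
  exact Finite.exists_max (G.margAdvantage i π s)

lemma margAdvantage_lt_of_notMem_bestActions (G : StochasticGame n S A) {π : JointPolicy S A}
    {i : Fin n} {s : S} {a b : A i} (ha : a ∈ G.bestActions π i s)
    (hb : b ∉ G.bestActions π i s) : G.margAdvantage i π s b < G.margAdvantage i π s a := by
  simp only [bestActions, Set.mem_ofPred_eq, not_forall, not_le] at hb
  obtain ⟨c, hc⟩ := hb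
  exact hc.trans_le (ha c)

lemma bestMass_pos (G : StochasticGame n S A) {π : JointPolicy S A}
    (hπ : ∀ i s a, 0 < (π i s).1 a) (i : Fin n) (s : S) : 0 < G.bestMass π i s := by
  classical
  obtain ⟨a, ha⟩ := G.exists_mem_bestActions π i s
  exact Finset.sum_pos (fun a _ => hπ i s a) ⟨a, by simpa using ha⟩

lemma iInf_pos_of_finite {ι : Sort*} [Finite ι] {f : ι → ℝ≥0∞} (hf : ∀ i, 0 < f i) :
    0 < ⨅ i, f i := by
  cases isEmpty_or_nonempty ι
  · rw [iInf_of_empty]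
    exact ENNReal.zero_lt_top
  · obtain ⟨i, hi⟩ := (Set.range_nonempty f).csInf_mem (Set.finite_range f)
    exact (hf i).trans_eq hi

lemma iInf_range_pos {f : ℕ → ℝ≥0∞} (K : ℕ) (hf : ∀ k, 0 < f k) :
    0 < ⨅ k ∈ range K, f k := by
  rw [← Finset.inf_eq_iInf, Finset.lt_inf_iff ENNReal.zero_lt_top]
  exact fun k _ => hf k

lemma minBestMass_pos (G : StochasticGame n S A) {π : ℕ → JointPolicy S A}
    (hπ : ∀ k i s a, 0 < (π k i s).1 a) (K : ℕ) : 0 < G.minBestMass π K :=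
  iInf_range_pos K fun k => iInf_pos_of_finite fun i => iInf_pos_of_finite fun s =>
    ENNReal.ofReal_pos.2 (G.bestMass_pos (hπ k) i s)

lemma subGap_pos (G : StochasticGame n S A) (π : JointPolicy S A) : 0 < G.subGap π :=
  iInf_pos_of_finite fun _ => iInf_pos_of_finite fun _ => iInf_pos_of_finite fun _ =>
    iInf_pos_of_finite fun ha => iInf_pos_of_finite fun _ => iInf_pos_of_finite fun hb =>
      ENNReal.ofReal_pos.2 (sub_pos.2 (G.margAdvantage_lt_of_notMem_bestActions ha hb))

lemma minSubGap_pos (G : StochasticGame n S A) (π : ℕ → JointPolicy S A) (K : ℕ) :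
    0 < G.minSubGap π K :=
  iInf_range_pos K fun k => G.subGap_pos (π k)

lemma minBestMass_le (G : StochasticGame n S A) (π : ℕ → JointPolicy S A) {K k : ℕ}
    (hk : k ∈ range K) (i : Fin n) (s : S) :
    G.minBestMass π K ≤ ENNReal.ofReal (G.bestMass (π k) i s) :=
  (iInf₂_le k hk).trans ((iInf_le _ i).trans (iInf_le _ s))

lemma minSubGap_le (G : StochasticGame n S A) (π : ℕ → JointPolicy S A) {K k : ℕ}
    (hk : k ∈ range K) {i : Fin n} {s : S} {a b : A i} (ha : a ∈ G.bestActions (π k) i s)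
    (hb : b ∉ G.bestActions (π k) i s) :
    G.minSubGap π K ≤
      ENNReal.ofReal (G.margAdvantage i (π k) s a - G.margAdvantage i (π k) s b) :=
  (iInf₂_le k hk).trans ((iInf_le _ i).trans ((iInf_le _ s).trans
    ((iInf₂_le a ha).trans (iInf₂_le b hb))))

/-! ### Summing over the iterations -/

lemma IsNPG.pos {G : StochasticGame n S A} {η : ℝ} {π : ℕ → JointPolicy S A}
    (h : G.IsNPG η π) (h0 : IsSoftmax (π 0)) (k : ℕ) (i : Fin n) (s : S) (a : A i) :
    0 < (π k i s).1 a := by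
  have hne : (univ : Finset (A i)).Nonempty := ⟨a, mem_univ a⟩
  induction k generalizing a with
  | zero =>
    obtain ⟨θ, hθ⟩ := h0
    rw [hθ]
    exact div_pos (Real.exp_pos _) (Finset.sum_pos (fun b _ => Real.exp_pos _) hne)
  | succ k ih =>
    rw [h]
    exact div_pos (mul_pos (ih a) (Real.exp_pos _))
      (Finset.sum_pos (fun b _ => mul_pos (ih b) (Real.exp_pos _)) hne)

/-- The gains of the steps are bounded by increments of the potential, which telescope. -/
lemma sum_neGap_le [NeZero n] {G : StochasticGame n S A} {φ : S → (∀ i, A i) → ℝ}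
    (hφ : G.IsPotential φ) {φmax : ℝ} (hφmax : 0 < φmax)
    (hbound : ∀ s a, 0 ≤ φ s a ∧ φ s a ≤ φmax) {π : ℕ → JointPolicy S A}
    (hπ : ∀ k i s a, 0 < (π k i s).1 a)
    (h_npg : G.IsNPG ((1 - G.γ) ^ 2 / (2 * √(n : ℝ) * φmax)) π) {M t : ℝ}
    (hM0 : 0 ≤ M) (hM : ∀ π s, 1 ≤ M * G.visitation π s) (ht : 0 ≤ t) (K : ℕ)
    (hmt : ∀ k ∈ range K, ∀ i s, ∃ m, (∀ b, G.margAdvantage i (π k) s b ≤ m) ∧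
      m ≤ (1 + t) * ∑ b, (π (k + 1) i s).1 b * G.margAdvantage i (π k) s b) :
    ∑ k ∈ range K, G.neGap (π k) ≤ 2 * M * φmax / (1 - G.γ) * (1 + t) := by
  have hγ := G.one_sub_γ_pos
  have hn : 0 < √(n : ℝ) := Real.sqrt_pos.2 (Nat.cast_pos.2 (NeZero.pos n))
  have hk : ∀ k ∈ range K, G.neGap (π k) ≤
      2 * M * (1 + t) * (G.valueInit φ (π (k + 1)) - G.valueInit φ (π k)) := by
    intro k hk
    choose m hm1 hm2 using hmt k hk
    have h1 := G.neGap_le hM0 (hM (π (k + 1))) m hm1 hm2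
    have h2 := half_stepGain_le hφ hφmax.le hbound (hπ k) (hπ (k + 1))
      (β := (1 - G.γ) / (2 * √n * φmax)) (by positivity) (le_of_eq (by field_simp)) (fun i s a => by
        have e : ∀ b, (1 - G.γ) ^ 2 / (2 * √(n : ℝ) * φmax) * G.margAdvantage i (π k) s b /
            (1 - G.γ) = (1 - G.γ) / (2 * √n * φmax) * G.margAdvantage i (π k) s b := by
          intro b; field_simp
        rw [h_npg]
        simp_rw [e])
    calc G.neGap (π k) ≤ M * (1 + t) * G.stepGain (π k) (π (k + 1)) := h1
      _ ≤ M * (1 + t) * (2 * (G.valueInit φ (π (k + 1)) - G.valueInit φ (π k))) :=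
        mul_le_mul_of_nonneg_left (by linarith) (by positivity)
      _ = _ := by ring
  refine (Finset.sum_le_sum hk).trans ?_
  rw [← Finset.mul_sum, Finset.sum_range_sub (fun k => G.valueInit φ (π k))]
  have h1 := (G.valueInit_mem_Icc (π K) hbound).2
  have h0 := (G.valueInit_mem_Icc (π 0) hbound).1
  calc 2 * M * (1 + t) * (G.valueInit φ (π K) - G.valueInit φ (π 0))
      ≤ 2 * M * (1 + t) * (φmax / (1 - G.γ)) :=
        mul_le_mul_of_nonneg_left (by linarith) (by positivity)
    _ = _ := by ring

/-- An infinite suboptimality gap means that `Ā_i` is constant in every state. -/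
lemma exists_max_le_of_minSubGap_eq_top {G : StochasticGame n S A} {π : ℕ → JointPolicy S A}
    {K : ℕ} (h : G.minSubGap π K = ⊤) {k : ℕ} (hk : k ∈ range K) (i : Fin n) (s : S) :
    ∃ m, (∀ b, G.margAdvantage i (π k) s b ≤ m) ∧
      m ≤ (1 + 0) * ∑ b, (π (k + 1) i s).1 b * G.margAdvantage i (π k) s b := by
  obtain ⟨a, ha⟩ := G.exists_mem_bestActions (π k) i s
  have hall : ∀ b, G.margAdvantage i (π k) s b = G.margAdvantage i (π k) s a := by
    intro b
    by_contra hne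
    have hb : b ∉ G.bestActions (π k) i s := fun hb => hne (le_antisymm (ha b) (hb a))
    have := G.minSubGap_le π hk ha hb
    rw [h] at this
    exact ENNReal.ofReal_ne_top (top_le_iff.1 this)
  refine ⟨_, fun b => (hall b).le, ?_⟩
  simp_rw [hall, ← Finset.sum_mul, (π (k + 1) i s).2.2]
  simp

/-- The maximum of `Ā_i` is within the factor `1 + 1 / (c β δ)` of its expectation under the next
policy, where `β = (1 - γ) / (2 √n φmax)` is the rate of the multiplicative weights. -/
lemma exists_max_le [NeZero n] {G : StochasticGame n S A} {φmax : ℝ} (hφmax : 0 < φmax)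
    {π : ℕ → JointPolicy S A} (hπ : ∀ k i s a, 0 < (π k i s).1 a)
    (h_npg : G.IsNPG ((1 - G.γ) ^ 2 / (2 * √(n : ℝ) * φmax)) π) {K : ℕ} {c δ : ℝ} (hc : 0 < c)
    (hδ : 0 < δ) (hcK : ENNReal.ofReal c ≤ G.minBestMass π K)
    (hδK : ENNReal.ofReal δ ≤ G.minSubGap π K) {k : ℕ} (hk : k ∈ range K) (i : Fin n) (s : S) :
    ∃ m, (∀ b, G.margAdvantage i (π k) s b ≤ m) ∧
      m ≤ (1 + 2 * √n * φmax / (c * δ * (1 - G.γ))) *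
        ∑ b, (π (k + 1) i s).1 b * G.margAdvantage i (π k) s b := by
  classical
  have hγ := G.one_sub_γ_pos
  have hn : 0 < √(n : ℝ) := Real.sqrt_pos.2 (Nat.cast_pos.2 (NeZero.pos n))
  obtain ⟨a, ha⟩ := G.exists_mem_bestActions (π k) i s
  have : Nonempty (A i) := ⟨a⟩
  refine ⟨G.margAdvantage i (π k) s a, ha, ?_⟩
  set β := (1 - G.γ) / (2 * √n * φmax) with hβ
  have hβ0 : 0 < β := by positivity
  have h := mul_max_le_one_add_mul_sum (hπ k i s) (π k i s).2.2
    (G.sum_mul_margAdvantage (π k) s i) hβ0 hδ (q := (π (k + 1) i s).1) (c := c)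
    (m := G.margAdvantage i (π k) s a)
    (fun a => by
      have e : ∀ b, (1 - G.γ) ^ 2 / (2 * √(n : ℝ) * φmax) * G.margAdvantage i (π k) s b /
          (1 - G.γ) = β * G.margAdvantage i (π k) s b := by
        intro b; rw [hβ]; field_simp
      rw [h_npg]
      simp_rw [e])
    (univ.filter fun a => a ∈ G.bestActions (π k) i s)
    (fun b hb => le_antisymm (ha b) ((mem_filter.1 hb).2 a))
    (fun b hb => by
      have hb' : b ∉ G.bestActions (π k) i s := by simpa using hb
      have h1 := hδK.trans (G.minSubGap_le π hk ha hb')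
      rw [ENNReal.ofReal_le_ofReal_iff (sub_nonneg.2 (ha b))] at h1
      linarith)
    (by
      have h1 := hcK.trans (G.minBestMass_le π hk i s)
      rw [ENNReal.ofReal_le_ofReal_iff (G.bestMass_pos (hπ k) i s).le] at h1
      refine h1.trans (le_of_eq ?_)
      unfold bestMass
      congr!)
  set x := c * β * δ with hx
  have hx0 : 0 < x := by positivity
  have ht : 1 + 2 * √n * φmax / (c * δ * (1 - G.γ)) = (1 + x) / x := by
    rw [hx, hβ]; field_simp; ring
  rw [ht, div_mul_eq_mul_div, le_div_iff₀ hx0]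
  linarith

/-- The bound on the average NE-gap in `[0, ∞]`. Only an infinite mismatch coefficient and an
infinite suboptimality gap need separate arguments. -/
lemma ofReal_average_neGap_le [NeZero n] {G : StochasticGame n S A} {φ : S → (∀ i, A i) → ℝ}
    (hφ : G.IsPotential φ) {φmax : ℝ} (hφmax : 0 < φmax)
    (hbound : ∀ s a, 0 ≤ φ s a ∧ φ s a ≤ φmax) {π : ℕ → JointPolicy S A}
    (hπ : ∀ k i s a, 0 < (π k i s).1 a)
    (h_npg : G.IsNPG ((1 - G.γ) ^ 2 / (2 * √(n : ℝ) * φmax)) π) {K : ℕ} (hK : 1 ≤ K) :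
    ENNReal.ofReal ((1 / (K : ℝ)) * ∑ k ∈ range K, G.neGap (π k)) ≤
      2 * G.mismatch * ENNReal.ofReal φmax / (K * ENNReal.ofReal (1 - G.γ)) *
        (1 + 2 * ENNReal.ofReal √(n : ℝ) * ENNReal.ofReal φmax /
          (G.minBestMass π K * G.minSubGap π K * ENNReal.ofReal (1 - G.γ))) := by
  have hγ := G.one_sub_γ_pos
  have hK0 : (0 : ℝ) < K := Nat.cast_pos.2 hK
  have hKγ : (K : ℝ≥0∞) * ENNReal.ofReal (1 - G.γ) = ENNReal.ofReal (K * (1 - G.γ)) := by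
    rw [ENNReal.ofReal_mul hK0.le, ENNReal.ofReal_natCast]
  rcases eq_or_ne G.mismatch ⊤ with hM | hM
  · -- The prefactor is infinite.
    have h1 : 2 * G.mismatch * ENNReal.ofReal φmax /
        (K * ENNReal.ofReal (1 - G.γ)) = ⊤ := by
      rw [hM, ENNReal.mul_top two_ne_zero, ENNReal.top_mul (by simpa using hφmax), hKγ,
        ENNReal.top_div_of_ne_top ENNReal.ofReal_ne_top]
    rw [h1, ENNReal.top_mul (by simp)]
    exact le_top
  have hbd : ∀ t : ℝ, 0 ≤ t → (∀ k ∈ range K, ∀ i s, ∃ m,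
      (∀ b, G.margAdvantage i (π k) s b ≤ m) ∧
        m ≤ (1 + t) * ∑ b, (π (k + 1) i s).1 b * G.margAdvantage i (π k) s b) →
      ENNReal.ofReal ((1 / (K : ℝ)) * ∑ k ∈ range K, G.neGap (π k)) ≤
        2 * G.mismatch * ENNReal.ofReal φmax / (K * ENNReal.ofReal (1 - G.γ)) *
          (1 + ENNReal.ofReal t) := by
    intro t ht hmt
    have h := sum_neGap_le hφ hφmax hbound hπ h_npg ENNReal.toReal_nonneg
      (G.one_le_mismatch_mul_visitation hM) ht K hmt
    have e : 2 * G.mismatch * ENNReal.ofReal φmax / (K * ENNReal.ofReal (1 - G.γ)) *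
        (1 + ENNReal.ofReal t) = ENNReal.ofReal
          (2 * G.mismatch.toReal * φmax / (K * (1 - G.γ)) * (1 + t)) := by
      rw [ENNReal.ofReal_mul (by positivity), ENNReal.ofReal_div_of_pos (by positivity),
        ENNReal.ofReal_mul (by positivity), ENNReal.ofReal_mul (by positivity),
        ENNReal.ofReal_toReal hM, hKγ, ENNReal.ofReal_add zero_le_one ht]
      simp
    rw [e]
    refine ENNReal.ofReal_le_ofReal ?_
    calc 1 / (K : ℝ) * ∑ k ∈ range K, G.neGap (π k)
        ≤ 1 / (K : ℝ) * (2 * G.mismatch.toReal * φmax / (1 - G.γ) * (1 + t)) :=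
          mul_le_mul_of_nonneg_left h (by positivity)
      _ = _ := by field_simp
  rcases eq_or_ne (G.minSubGap π K) ⊤ with hδ | hδ
  · -- All actions are best throughout, so nothing can be gained.
    refine (hbd 0 le_rfl fun k hk i s => exists_max_le_of_minSubGap_eq_top hδ hk i s).trans ?_
    gcongr
    simp
  · have hS : Nonempty S := by
      by_contra h
      rw [not_nonempty_iff] at h
      simpa using G.ρ.2.2
    have hc : G.minBestMass π K ≠ ⊤ := ne_top_of_le_ne_top ENNReal.ofReal_ne_top
      (G.minBestMass_le π (mem_range.2 hK) (Fin.ofNat n 0) hS.some)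
    have hc0 := ENNReal.toReal_pos (G.minBestMass_pos hπ K).ne' hc
    have hδ0 := ENNReal.toReal_pos (G.minSubGap_pos π K).ne' hδ
    refine (hbd (2 * √n * φmax / ((G.minBestMass π K).toReal * (G.minSubGap π K).toReal *
      (1 - G.γ))) (by positivity) fun k hk i s => exists_max_le hφmax hπ h_npg hc0 hδ0
        (ENNReal.ofReal_toReal hc).le (ENNReal.ofReal_toReal hδ).le hk i s).trans ?_
    rw [ENNReal.ofReal_div_of_pos (by positivity), ENNReal.ofReal_mul (by positivity),
      ENNReal.ofReal_mul (by positivity), ENNReal.ofReal_mul (by positivity),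
      ENNReal.ofReal_mul (by positivity), ENNReal.ofReal_toReal hc, ENNReal.ofReal_toReal hδ]
    simp

end StochasticGame

end

/-! ### The convergence bound -/

theorem theorem2 {n : ℕ} [NeZero n] {S : Type*} {A : Fin n → Type*} [Fintype S] [DecidableEq S]
    [∀ i, Fintype (A i)] [∀ i, DecidableEq (A i)] (G : StochasticGame n S A)
    (φ : S → (∀ i, A i) → ℝ) (hφ : G.IsPotential φ)
    (φmax : ℝ) (hφmax : 0 < φmax) (hbound : ∀ s a, 0 ≤ φ s a ∧ φ s a ≤ φmax)
    (π : ℕ → JointPolicy S A) (h_softmax : IsSoftmax (π 0))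
    (h_npg : G.IsNPG ((1 - G.γ) ^ 2 / (2 * √(n : ℝ) * φmax)) π) :
    (∀ K : ℕ, 1 ≤ K →
      0 < G.minBestMass π K ∧ 0 < G.minSubGap π K ∧
      ENNReal.ofReal ((1 / (K : ℝ)) * ∑ k ∈ Finset.range K, G.neGap (π k)) ≤
        2 * G.mismatch * ENNReal.ofReal φmax / (K * ENNReal.ofReal (1 - G.γ)) *
          (1 + 2 * ENNReal.ofReal √(n : ℝ) * ENNReal.ofReal φmax /
            (G.minBestMass π K * G.minSubGap π K * ENNReal.ofReal (1 - G.γ))) ∧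
      ENNReal.ofReal ((1 / (K : ℝ)) * ∑ k ∈ Finset.range K, G.neGap (π k)) ≤
        2 * G.mismatch * ENNReal.ofReal φmax / (K * ENNReal.ofReal (1 - G.γ)) *
          (1 + 2 * ENNReal.ofReal √(n : ℝ) * ENNReal.ofReal φmax /
            (G.infBestMass π * G.minSubGap π K * ENNReal.ofReal (1 - G.γ)))) ∧
    (∀ ε : ℝ, 0 < ε → ∀ K : ℕ, 1 ≤ K →
      2 * G.mismatch * ENNReal.ofReal φmax / (ENNReal.ofReal ε * ENNReal.ofReal (1 - G.γ)) *
          (1 + 2 * ENNReal.ofReal √(n : ℝ) * ENNReal.ofReal φmax /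
            (G.infBestMass π * G.infSubGap π * ENNReal.ofReal (1 - G.γ))) ≤ (K : ℝ≥0∞) →
      (1 / (K : ℝ)) * ∑ k ∈ Finset.range K, G.neGap (π k) ≤ ε) := by
  have hπ := h_npg.pos h_softmax
  have hmin : ∀ K, G.infBestMass π ≤ G.minBestMass π K := fun K =>
    le_iInf₂ fun k _ => iInf_le _ k
  have hgap : ∀ K, G.infSubGap π ≤ G.minSubGap π K := fun K =>
    le_iInf₂ fun k _ => iInf_le _ k
  have hbd := fun (K : ℕ) (hK : 1 ≤ K) =>
    StochasticGame.ofReal_average_neGap_le hφ hφmax hbound hπ h_npg hK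
  refine ⟨fun K hK => ⟨G.minBestMass_pos hπ K, G.minSubGap_pos π K, hbd K hK,
    (hbd K hK).trans ?_⟩, fun ε hε K hK hKε => ?_⟩
  · gcongr
    exact hmin K
  · rw [← ENNReal.ofReal_le_ofReal_iff hε.le]
    have hγ : ENNReal.ofReal (1 - G.γ) ≠ 0 := by simpa using G.γ_mem.2
    have hε' : ENNReal.ofReal ε ≠ 0 := by simpa using hε
    have hK' : (K : ℝ≥0∞) ≠ 0 := by simpa using Nat.one_le_iff_ne_zero.1 hK
    refine (hbd K hK).trans ?_
    calc _ ≤ 2 * G.mismatch * ENNReal.ofReal φmax / (K * ENNReal.ofReal (1 - G.γ)) *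
          (1 + 2 * ENNReal.ofReal √(n : ℝ) * ENNReal.ofReal φmax /
            (G.infBestMass π * G.infSubGap π * ENNReal.ofReal (1 - G.γ))) := by
          gcongr
          exacts [hmin K, hgap K]
      _ ≤ ENNReal.ofReal ε := by
          -- Both inequalities say that the numerator is at most `K ε (1 - γ)`.
          rw [← ENNReal.mul_div_right_comm, ENNReal.div_le_iff
            (mul_ne_zero hε' hγ) (ENNReal.mul_ne_top ENNReal.ofReal_ne_top
              ENNReal.ofReal_ne_top)] at hKε
          rw [← ENNReal.mul_div_right_comm, ENNReal.div_le_iff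
            (mul_ne_zero hK' hγ) (ENNReal.mul_ne_top (ENNReal.natCast_ne_top K)
              ENNReal.ofReal_ne_top), mul_left_comm]
          exact hKε
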